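/- For $0\le\theta<\pi$ let $\widetilde{\mathcal M}_6(\theta)$ be the set of hexagons $\mathcal P=(P_0,\dots,P_5)$ with labelled vertices $P_i\in\mathbb R^3$ such that $|P_i-P_{i+1}|=1$ and $\angle P_{i-1}P_iP_{i+1}=\theta$ for all $i$ (indices modulo $6$; vertices may coincide and edges may intersect), with the topology induced from $(\mathbb R^3)^6$. Let $\mathcal M_6(\theta)=\widetilde{\mathcal M}_6(\theta)/G$ be the configuration space, with the quotient topology, where $G$ is the group of orientation preserving isometries of $\mathbb R^3$, and write $[\mathcal P]$ for the class of $\mathcal P$. A hexagon $\mathcal P\in\widetilde{\mathcal M}_6(\theta)$ is called a \emph{boat} (respectively a \emph{chair}) if for some $i$ one has $\overrightarrow{P_{i-1}P_{i-2}}=\overrightarrow{P_{i+1}P_{i+2}}$ and the points $P_i$ and $P_{i+3}$ lie strictly on the same side (respectively strictly on opposite sides) of the plane spanned by $P_{i-1},P_{i+1},P_{i+2},P_{i-2}$. (Such hexagons exist only for $0<\theta<\frac{2\pi}{3}$.) The mirror image $\mathcal P^*$ of $\mathcal P$ is its image under reflection in a plane; the class $[\mathcal P^*]$ does not depend on the plane.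 Let $0\le\theta<\pi$. 1. If $\theta\neq\frac{\pi}{3}$ and $\mathcal B\in\widetilde{\mathcal M}_6(\theta)$ is a boat, then $[\mathcal B]$ and $[\mathcal B^*]$ can be joined by a path in $\mathcal M_6(\theta)$ if and only if $\frac{\pi}{3}<\theta<\frac{2\pi}{3}$. 2. If $\mathcal B\in\widetilde{\mathcal M}_6(\theta)$ is a boat and $\mathcal K\in\widetilde{\mathcal M}_6(\theta)$ is a chair, then $[\mathcal B]$ and $[\mathcal K]$ cannot be joined by a path in $\mathcal M_6(\theta)$. -/

import Mathlib

open Real EuclideanGeometry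

/-- Euclidean three-space. -/
abbrev Space3 : Type := EuclideanSpace ℝ (Fin 3)

/-- `P` is a `θ`-equiangular unit equilateral polygon with (labelled) vertices `P 0, …, P (n-1)`.
Suffixes are taken modulo `n`, which is what addition in `Fin n` does. -/
def IsEquiangularUnitPolygon (n : ℕ) [NeZero n] (θ : ℝ) (P : Fin n → Space3) : Prop :=
  ∀ i : Fin n, dist (P i) (P (i + 1)) = 1 ∧ ∠ (P (i - 1)) (P i) (P (i + 1)) = θ

/-- The space of `θ`-equiangular unit equilateral `n`-gons in three-space, topologized as a
subspace of the space of all `n`-tuples of points. -/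
abbrev EquiangularPolygon (n : ℕ) [NeZero n] (θ : ℝ) : Type :=
  {P : Fin n → Space3 // IsEquiangularUnitPolygon n θ P}

/-- The group of orientation preserving isometries of three-space. -/
def orientationPreservingIsometries : Subgroup (Space3 ≃ᵃⁱ[ℝ] Space3) where
  carrier := {g | 0 < LinearMap.det (g.linearIsometryEquiv.toLinearEquiv : Space3 →ₗ[ℝ] Space3)}
  one_mem' := by
    change 0 < LinearMap.det (LinearMap.id : Space3 →ₗ[ℝ] Space3)
    simp
  mul_mem' := by
    intro g h hg hh
    change 0 < LinearMap.det
      ((g.linearIsometryEquiv.toLinearEquiv : Space3 →ₗ[ℝ] Space3) ∘ₗ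
        (h.linearIsometryEquiv.toLinearEquiv : Space3 →ₗ[ℝ] Space3))
    rw [LinearMap.det_comp]
    exact mul_pos hg hh
  inv_mem' := by
    intro g hg
    change 0 < LinearMap.det
      ((g.linearIsometryEquiv.toLinearEquiv.symm : Space3 ≃ₗ[ℝ] Space3) : Space3 →ₗ[ℝ] Space3)
    have h := LinearEquiv.det_mul_det_symm g.linearIsometryEquiv.toLinearEquiv
    have hg' : 0 < LinearMap.det
      (g.linearIsometryEquiv.toLinearEquiv : Space3 →ₗ[ℝ] Space3) := hg
    exact pos_of_mul_pos_right (h ▸ one_pos) hg'.le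

/-- Two polygons are equivalent if an orientation preserving isometry maps one to the other,
respecting the labels of the vertices. -/
instance congruenceSetoid (n : ℕ) [NeZero n] (θ : ℝ) : Setoid (EquiangularPolygon n θ) where
  r P Q := ∃ g ∈ orientationPreservingIsometries, ∀ i, g (P.1 i) = Q.1 i
  iseqv :=
    { refl := fun _ => ⟨1, one_mem _, fun _ => rfl⟩
      symm := by
        rintro P Q ⟨g, hg, h⟩
        exact ⟨g⁻¹, inv_mem hg, fun i => by
          rw [← h i]; exact g.symm_apply_apply _⟩
      trans := by
        rintro P Q R ⟨g, hg, h⟩ ⟨k, hk, h'⟩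
        exact ⟨k * g, mul_mem hk hg, fun i => by
          rw [← h' i, ← h i]; rfl⟩ }

/-- The configuration space of `θ`-equiangular unit equilateral `n`-gons, with the quotient
topology. -/
abbrev ConfigurationSpace (n : ℕ) [NeZero n] (θ : ℝ) : Type :=
  Quotient (congruenceSetoid n θ)

/-- The class of a polygon in the configuration space. -/
def EquiangularPolygon.toConfig {n : ℕ} [NeZero n] {θ : ℝ} (P : EquiangularPolygon n θ) :
    ConfigurationSpace n θ :=
  Quotient.mk (congruenceSetoid n θ) P

/-- The reflection of three-space in the horizontal coordinate plane. -/
noncomputable def horizontalReflection : Space3 ≃ₗᵢ[ℝ] Space3 :=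
  (Submodule.span ℝ {(EuclideanSpace.single 2 1 : Space3)})ᗮ.reflection

/-- The mirror image of a polygon. Its class in the configuration space does not depend on the
plane of reflection. -/
noncomputable def EquiangularPolygon.mirror {n : ℕ} [NeZero n] {θ : ℝ}
    (P : EquiangularPolygon n θ) : EquiangularPolygon n θ :=
  ⟨fun i => horizontalReflection (P.1 i), fun i => by
    refine ⟨?_, ?_⟩
    · rw [horizontalReflection.dist_map]
      exact (P.2 i).1
    · exact (AffineIsometry.angle_map
        horizontalReflection.toLinearIsometry.toAffineIsometry _ _ _).trans (P.2 i).2⟩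

/-- The four vertices of a hexagon other than `P i` and `P (i + 3)` form a parallelogram
`P (i - 1), P (i + 1), P (i + 2), P (i - 2)`. -/
def HasParallelogram (P : Fin 6 → Space3) (i : Fin 6) : Prop :=
  P (i - 2) - P (i - 1) = P (i + 2) - P (i + 1)

/-- The affine span of the four vertices of a hexagon other than `P i` and `P (i + 3)`. -/
noncomputable def basePlane (P : Fin 6 → Space3) (i : Fin 6) : AffineSubspace ℝ Space3 :=
  affineSpan ℝ {P (i - 1), P (i + 1), P (i + 2), P (i - 2)}

/-- A boat: four vertices form a parallelogram and the two remaining (opposite) vertices lie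
strictly on the same side of its plane. -/
def EquiangularPolygon.IsBoat {θ : ℝ} (P : EquiangularPolygon 6 θ) : Prop :=
  ∃ i : Fin 6, HasParallelogram P.1 i ∧ (basePlane P.1 i).SSameSide (P.1 i) (P.1 (i + 3))

/-- A chair: four vertices form a parallelogram and the two remaining (opposite) vertices lie
strictly on opposite sides of its plane. -/
def EquiangularPolygon.IsChair {θ : ℝ} (P : EquiangularPolygon 6 θ) : Prop :=
  ∃ i : Fin 6, HasParallelogram P.1 i ∧ (basePlane P.1 i).SOppSide (P.1 i) (P.1 (i + 3))

/-!
Let `e₀, …, e₅` be the edge vectors of a `θ`-equiangular unit hexagon and put `k = 2 - 2 cos θ`,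
the squared length of the short diagonals. Since `∑ eᵢ = 0`, the rows of the Gram matrix of the
edges sum to zero, and as consecutive edges have a prescribed inner product this forces `⟪eᵢ, eᵢ₊₂⟫
= ⟪eᵢ₊₃, eᵢ₊₅⟫`: the shift by three preserves the Gram matrix. Hence the even parts `f = (e₀ + e₃,
e₄ + e₁, e₂ + e₅)` are orthogonal to the odd parts `h = (e₀ - e₃, e₄ - e₁, e₂ - e₅)`, and being a
hexagon becomes the short list of equations `IsSplitHexagon`. In three-space the spans of `f` and
`h` have dimensions adding up to at most three.

*Chairs.* If the `hᵢ` are independent, then `f = 0` and the squared volume spanned by the `hᵢ` is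
`16 k² (3 - k)`; otherwise it is `0`. So this volume is locally constant on the configuration
space. Chairs are centrally symmetric, that is `f = 0`, while a boat has `f ≠ 0` and hence volume
`0` (`not_joined_boat_chair`).

*Boats for `k < 1`.* The Gram determinant of `f₀, f₁` is likewise locally constant: it is `0` or
`12 k²`. Hence along a path starting at a boat all even parts are multiples `φᵢ n` of one unit
vector `n`, which is orthogonal to the odd parts. Put `ρ = ∑ φᵢ²`. Coplanarity of the `hᵢ` reads
`(φ₀ φ₁ φ₂)² = 2 k ρ - 4 k² (3 - k)`, and `ρ ≤ 6 k` because `2 k (6 k - ρ)` is a squared area. The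
chirality `∑ det (fᵢ, hᵢ, h₀ + h₁ + h₂)` changes sign under reflections and has square `4 k (36 k
(3 - k) - 6 k ρ - ρ²)`, which is positive for `k < 1`. So it cannot change sign along the path, and
the mirror image is not reached (`not_joined_boat_mirror`).

*Boats for `1 < k < 3`.* Put `φᵢ = 2 √z cos (α + 2 π i / 3)`. The coplanarity equation becomes
`cos² (3 α) z³ - 3 k z + k² (3 - k) = 0`, which has a root `z ∈ (0, 1)` depending continuously on
`α`. The Gram matrix of the odd parts is then singular with sum of cofactors `2 k (6 k - ρ) > 0`,
so that a kernel vector of it, and with it the odd parts in a fixed plane, can be chosen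
continuously in `α` and depending on `φ` only up to sign. Moving `α` through a half turn, starting
at a boat, replaces `φ` by `-φ` and restores the odd parts, that is, it ends at the reflection of
the boat (`joined_boat_mirror`). Finally a boat has `⟪f, f⟫ = k (3 - k)` for its nonzero even
parts, so boats only exist for `0 < k < 3`.
-/

open scoped InnerProductSpace

/-! ### Even and odd parts of a hexagon -/

/-- The `i`-th edge vector of a hexagon. -/
def edge (P : Fin 6 → Space3) (i : Fin 6) : Space3 := P (i + 1) - P i

/-- The sums of opposite edge vectors. Starting at the edges `0`, `4`, `2` makes the relations with
`oddPart` symmetric in the three indices. -/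
def evenPart (P : Fin 6 → Space3) : Fin 3 → Space3 :=
  ![edge P 0 + edge P 3, edge P 4 + edge P 1, edge P 2 + edge P 5]

/-- The differences of opposite edge vectors, in the order of `evenPart`. -/
def oddPart (P : Fin 6 → Space3) : Fin 3 → Space3 :=
  ![edge P 0 - edge P 3, edge P 4 - edge P 1, edge P 2 - edge P 5]

/-- The relations between the even parts `f` and the odd parts `h` of an equiangular unit hexagon
whose short diagonals have squared length `k = 2 - 2 cos θ`. -/
structure IsSplitHexagon (k : ℝ) (f h : Fin 3 → Space3) : Prop where
  sum_eq_zero : f 0 + f 1 + f 2 = 0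
  ortho : ∀ i j, ⟪f i, h j⟫_ℝ = 0
  diag : ∀ i, ⟪h i, h i⟫_ℝ = 4 - ⟪f i, f i⟫_ℝ
  cross : ∀ i j, i ≠ j → ⟪h i, h j⟫_ℝ = ⟪f i, f j⟫_ℝ + 4 - 2 * k

theorem sum_edge (P : Fin 6 → Space3) :
    edge P 0 + edge P 1 + edge P 2 + edge P 3 + edge P 4 + edge P 5 = 0 := by
  simp only [edge, show (0 : Fin 6) + 1 = 1 from rfl, show (1 : Fin 6) + 1 = 2 from rfl,
    show (2 : Fin 6) + 1 = 3 from rfl, show (3 : Fin 6) + 1 = 4 from rfl,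
    show (4 : Fin 6) + 1 = 5 from rfl, show (5 : Fin 6) + 1 = 0 from rfl]
  abel

theorem isEquiangularUnitPolygon_iff_edge {θ : ℝ} (hθ₀ : 0 ≤ θ) (hθπ : θ ≤ π)
    (P : Fin 6 → Space3) :
    IsEquiangularUnitPolygon 6 θ P ↔
      ∀ i, ⟪edge P i, edge P i⟫_ℝ = 1 ∧ ⟪edge P i, edge P (i + 1)⟫_ℝ = -cos θ := by
  have hnorm : ∀ i, dist (P i) (P (i + 1)) = 1 ↔ ⟪edge P i, edge P i⟫_ℝ = 1 := fun i => by
    rw [real_inner_self_eq_norm_sq, edge, dist_comm, dist_eq_norm,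
      pow_eq_one_iff_of_nonneg (norm_nonneg _) two_ne_zero]
  have hangle : ∀ i, ⟪edge P i, edge P i⟫_ℝ = 1 →
      ⟪edge P (i + 1), edge P (i + 1)⟫_ℝ = 1 →
      (∠ (P (i + 1 - 1)) (P (i + 1)) (P (i + 1 + 1)) = θ ↔
        ⟪edge P i, edge P (i + 1)⟫_ℝ = -cos θ) := fun i h₁ h₂ => by
    have e₁ : P i - P (i + 1) = -edge P i := by simp [edge]
    have n₁ : ‖edge P i‖ = 1 := by
      rw [real_inner_self_eq_norm_sq] at h₁
      nlinarith [norm_nonneg (edge P i)]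
    have n₂ : ‖edge P (i + 1)‖ = 1 := by
      rw [real_inner_self_eq_norm_sq] at h₂
      nlinarith [norm_nonneg (edge P (i + 1))]
    have key : ∠ (P (i + 1 - 1)) (P (i + 1)) (P (i + 1 + 1)) =
        arccos (-⟪edge P i, edge P (i + 1)⟫_ℝ) := by
      rw [EuclideanGeometry.angle, InnerProductGeometry.angle, add_sub_cancel_right, vsub_eq_sub,
        vsub_eq_sub, e₁, show P (i + 1 + 1) - P (i + 1) = edge P (i + 1) from rfl, norm_neg, n₁,
        n₂, inner_neg_left, one_mul, div_one]
    rw [key]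
    have hle := abs_le.1 (abs_real_inner_le_norm (edge P i) (edge P (i + 1)))
    rw [n₁, n₂, one_mul] at hle
    constructor
    · intro h
      rw [← h, cos_arccos (by linarith [hle.2]) (by linarith [hle.1]), neg_neg]
    · intro h
      rw [h, neg_neg, arccos_cos hθ₀ hθπ]
  constructor
  · intro h i
    have h₁ := (hnorm i).1 (h i).1
    exact ⟨h₁, (hangle i h₁ ((hnorm _).1 (h (i + 1)).1)).1 (h (i + 1)).2⟩
  · intro h i
    refine ⟨(hnorm i).2 (h i).1, ?_⟩
    have := (hangle (i - 1) (h _).1 (h _).1).2 (h _).2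
    rwa [sub_add_cancel] at this

/-- The relations are linear in the Gram matrix of the edges; that even and odd parts are orthogonal
and the cross terms agree uses that the rows of this matrix sum to zero. -/
theorem isSplitHexagon_of_isEquiangularUnitPolygon {θ : ℝ} (hθ₀ : 0 ≤ θ) (hθπ : θ ≤ π)
    {P : Fin 6 → Space3} (hP : IsEquiangularUnitPolygon 6 θ P) :
    IsSplitHexagon (2 - 2 * cos θ) (evenPart P) (oddPart P) := by
  rw [isEquiangularUnitPolygon_iff_edge hθ₀ hθπ] at hP
  have hs := sum_edge P
  simp only [Fin.forall_fin_succ, IsEmpty.forall_iff] at hP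
  obtain ⟨⟨a0, b0⟩, ⟨a1, b1⟩, ⟨a2, b2⟩, ⟨a3, b3⟩, ⟨a4, b4⟩, ⟨a5, b5⟩, -⟩ := hP
  change ⟪edge P 0, edge P 0⟫_ℝ = 1 at a0
  change ⟪edge P 1, edge P 1⟫_ℝ = 1 at a1
  change ⟪edge P 2, edge P 2⟫_ℝ = 1 at a2
  change ⟪edge P 3, edge P 3⟫_ℝ = 1 at a3
  change ⟪edge P 4, edge P 4⟫_ℝ = 1 at a4
  change ⟪edge P 5, edge P 5⟫_ℝ = 1 at a5
  change ⟪edge P 0, edge P 1⟫_ℝ = -cos θ at b0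
  change ⟪edge P 1, edge P 2⟫_ℝ = -cos θ at b1
  change ⟪edge P 2, edge P 3⟫_ℝ = -cos θ at b2
  change ⟪edge P 3, edge P 4⟫_ℝ = -cos θ at b3
  change ⟪edge P 4, edge P 5⟫_ℝ = -cos θ at b4
  change ⟪edge P 5, edge P 0⟫_ℝ = -cos θ at b5
  unfold evenPart oddPart
  generalize edge P 0 = x0 at *
  generalize edge P 1 = x1 at *
  generalize edge P 2 = x2 at *
  generalize edge P 3 = x3 at *
  generalize edge P 4 = x4 at *
  generalize edge P 5 = x5 at *
  have r : ∀ y, ⟪x0, y⟫_ℝ + ⟪x1, y⟫_ℝ + ⟪x2, y⟫_ℝ + ⟪x3, y⟫_ℝ + ⟪x4, y⟫_ℝ + ⟪x5, y⟫_ℝ = 0 := by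
    intro y
    simp only [← inner_add_left, hs, inner_zero_left]
  have r0 := r x0
  have r1 := r x1
  have r2 := r x2
  have r3 := r x3
  have r4 := r x4
  have r5 := r x5
  -- all claims are now linear in the 21 inner products of the edges
  have c : ∀ y z : Space3, ⟪y, z⟫_ℝ = ⟪z, y⟫_ℝ := fun y z => real_inner_comm z y
  have c01 := c x0 x1
  have c02 := c x0 x2
  have c03 := c x0 x3
  have c04 := c x0 x4
  have c05 := c x0 x5
  have c12 := c x1 x2
  have c13 := c x1 x3
  have c14 := c x1 x4
  have c15 := c x1 x5
  have c23 := c x2 x3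
  have c24 := c x2 x4
  have c25 := c x2 x5
  have c34 := c x3 x4
  have c35 := c x3 x5
  have c45 := c x4 x5
  refine ⟨?_, ?_, ?_, ?_⟩
  · simp only [Matrix.cons_val]
    rw [← hs]
    abel
  · intro i j
    fin_cases i <;> fin_cases j <;>
      simp only [Fin.zero_eta, Fin.mk_one, Fin.reduceFinMk, Matrix.cons_val, inner_add_left,
        inner_sub_right] <;>
      linarith
  · intro i
    fin_cases i <;>
      simp only [Fin.zero_eta, Fin.mk_one, Fin.reduceFinMk, Matrix.cons_val, inner_add_left,
        inner_sub_right, inner_add_right, inner_sub_left] <;>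
      linarith
  · intro i j hij
    fin_cases i <;> fin_cases j <;> first
      | exact absurd rfl hij
      | simp only [Fin.zero_eta, Fin.mk_one, Fin.reduceFinMk, Matrix.cons_val, inner_add_left,
          inner_sub_right, inner_add_right, inner_sub_left]
        linarith

/-! ### Triple products -/

/-- The scalar triple product of three vectors of Euclidean three-space. -/
def triple (a b c : Space3) : ℝ :=
  a 0 * (b 1 * c 2 - b 2 * c 1) - a 1 * (b 0 * c 2 - b 2 * c 0) + a 2 * (b 0 * c 1 - b 1 * c 0)

theorem inner_eq_sum_three (a b : Space3) : ⟪a, b⟫_ℝ = a 0 * b 0 + a 1 * b 1 + a 2 * b 2 := by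
  simp only [PiLp.inner_apply, Fin.sum_univ_three, RCLike.inner_apply, conj_trivial]
  ring

/-- The square of the triple product is the Gram determinant. -/
theorem triple_sq (a b c : Space3) :
    triple a b c ^ 2 = ⟪a, a⟫_ℝ * ⟪b, b⟫_ℝ * ⟪c, c⟫_ℝ + 2 * ⟪a, b⟫_ℝ * ⟪b, c⟫_ℝ * ⟪a, c⟫_ℝ
      - ⟪a, a⟫_ℝ * ⟪b, c⟫_ℝ ^ 2 - ⟪b, b⟫_ℝ * ⟪a, c⟫_ℝ ^ 2 - ⟪c, c⟫_ℝ * ⟪a, b⟫_ℝ ^ 2 := by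
  simp only [inner_eq_sum_three, triple]
  ring

theorem triple_sq_of_orthogonal {n a b : Space3} (hn : ⟪n, n⟫_ℝ = 1) (ha : ⟪n, a⟫_ℝ = 0)
    (hb : ⟪n, b⟫_ℝ = 0) : triple n a b ^ 2 = ⟪a, a⟫_ℝ * ⟪b, b⟫_ℝ - ⟪a, b⟫_ℝ ^ 2 := by
  rw [triple_sq, hn, ha, hb]
  ring

theorem eq_zero_of_triple_ne_zero {n a b c : Space3} (h : triple a b c ≠ 0) (ha : ⟪n, a⟫_ℝ = 0)
    (hb : ⟪n, b⟫_ℝ = 0) (hc : ⟪n, c⟫_ℝ = 0) : n = 0 := by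
  rw [inner_eq_sum_three] at ha hb hc
  have h0 : triple a b c * n 0 = 0 := by
    unfold triple
    linear_combination (b 1 * c 2 - b 2 * c 1) * ha + (c 1 * a 2 - c 2 * a 1) * hb +
      (a 1 * b 2 - a 2 * b 1) * hc
  have h1 : triple a b c * n 1 = 0 := by
    unfold triple
    linear_combination (b 2 * c 0 - b 0 * c 2) * ha + (c 2 * a 0 - c 0 * a 2) * hb +
      (a 2 * b 0 - a 0 * b 2) * hc
  have h2 : triple a b c * n 2 = 0 := by
    unfold triple
    linear_combination (b 0 * c 1 - b 1 * c 0) * ha + (c 0 * a 1 - c 1 * a 0) * hb +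
      (a 0 * b 1 - a 1 * b 0) * hc
  ext i
  fin_cases i
  · exact (mul_eq_zero.1 h0).resolve_left h
  · exact (mul_eq_zero.1 h1).resolve_left h
  · exact (mul_eq_zero.1 h2).resolve_left h

theorem triple_smul_left (r : ℝ) (a b c : Space3) : triple (r • a) b c = r * triple a b c := by
  simp only [triple, PiLp.smul_apply, smul_eq_mul]
  ring

theorem triple_eq_det (a b c : Space3) :
    triple a b c = (EuclideanSpace.basisFun (Fin 3) ℝ).toBasis.det ![a, b, c] := by
  rw [Module.Basis.det_apply, Matrix.det_fin_three]
  simp [Module.Basis.toMatrix_apply, triple]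
  ring

theorem triple_map (L : Space3 ≃ₗᵢ[ℝ] Space3) (a b c : Space3) :
    triple (L a) (L b) (L c) =
      LinearMap.det (L.toLinearEquiv : Space3 →ₗ[ℝ] Space3) * triple a b c := by
  rw [triple_eq_det, triple_eq_det, ← Module.Basis.det_comp]
  congr 1
  ext i
  fin_cases i <;> rfl

theorem det_eq_one_of_pos (L : Space3 ≃ₗᵢ[ℝ] Space3)
    (h : 0 < LinearMap.det (L.toLinearEquiv : Space3 →ₗ[ℝ] Space3)) :
    LinearMap.det (L.toLinearEquiv : Space3 →ₗ[ℝ] Space3) = 1 := by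
  set v : Fin 3 → Space3 := fun i => EuclideanSpace.single i 1
  have hv : triple (v 0) (v 1) (v 2) = 1 := by simp [triple, v]
  have h₁ := triple_map L (v 0) (v 1) (v 2)
  have h₂ : triple (L (v 0)) (L (v 1)) (L (v 2)) ^ 2 = triple (v 0) (v 1) (v 2) ^ 2 := by
    simp only [triple_sq, LinearIsometryEquiv.inner_map_map]
  rw [h₁, hv, mul_one, one_pow] at h₂
  nlinarith

theorem det_horizontalReflection :
    LinearMap.det (horizontalReflection.toLinearEquiv : Space3 →ₗ[ℝ] Space3) = -1 := by
  have h := (Submodule.span ℝ {(EuclideanSpace.single 2 1 : Space3)})ᗮ.det_reflection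
  rw [Submodule.orthogonal_orthogonal, finrank_span_singleton (by simp), pow_one] at h
  exact h

/-- The Gram determinant of two triples which share two vectors. -/
theorem triple_mul_triple (a b x y : Space3) :
    triple a x y * triple b x y =
      ⟪a, b⟫_ℝ * (⟪x, x⟫_ℝ * ⟪y, y⟫_ℝ - ⟪x, y⟫_ℝ ^ 2)
      - ⟪a, x⟫_ℝ * (⟪x, b⟫_ℝ * ⟪y, y⟫_ℝ - ⟪x, y⟫_ℝ * ⟪y, b⟫_ℝ)
      + ⟪a, y⟫_ℝ * (⟪x, b⟫_ℝ * ⟪x, y⟫_ℝ - ⟪x, x⟫_ℝ * ⟪y, b⟫_ℝ) := by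
  simp only [inner_eq_sum_three, triple]
  ring

/-- The chirality of a hexagon with even parts `f` and odd parts `h`: it is invariant under
rotations and changes sign under reflections. -/
def twist (f h : Fin 3 → Space3) : ℝ :=
  triple (f 0) (h 0) (h 0 + h 1 + h 2) + triple (f 1) (h 1) (h 0 + h 1 + h 2) +
    triple (f 2) (h 2) (h 0 + h 1 + h 2)

/-! ### Restrictions on the even and odd parts -/

namespace IsSplitHexagon

variable {k : ℝ} {f h : Fin 3 → Space3}

theorem even_eq_zero_of_triple_ne_zero (H : IsSplitHexagon k f h)
    (hD : triple (h 0) (h 1) (h 2) ≠ 0) (i : Fin 3) : f i = 0 :=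
  eq_zero_of_triple_ne_zero hD (H.ortho i 0) (H.ortho i 1) (H.ortho i 2)

theorem triple_sq_of_even_eq_zero (H : IsSplitHexagon k f h) (hf : ∀ i, f i = 0) :
    triple (h 0) (h 1) (h 2) ^ 2 = 16 * k ^ 2 * (3 - k) := by
  rw [triple_sq, H.diag, H.diag, H.diag, H.cross 0 1 (by decide), H.cross 1 2 (by decide),
    H.cross 0 2 (by decide), hf, hf, hf, inner_zero_left]
  ring

/-- The squared volume spanned by the odd parts takes only two values. -/
theorem triple_sq_eq_zero_or (H : IsSplitHexagon k f h) :
    triple (h 0) (h 1) (h 2) ^ 2 = 0 ∨ triple (h 0) (h 1) (h 2) ^ 2 = 16 * k ^ 2 * (3 - k) := by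
  by_cases hD : triple (h 0) (h 1) (h 2) = 0
  · left
    rw [hD]
    ring
  · exact Or.inr (H.triple_sq_of_even_eq_zero (H.even_eq_zero_of_triple_ne_zero hD))

/-- The inner products of the even parts are determined by their norms, as their sum vanishes. -/
theorem inner_even (H : IsSplitHexagon k f h) :
    2 * ⟪f 0, f 1⟫_ℝ = ⟪f 2, f 2⟫_ℝ - ⟪f 0, f 0⟫_ℝ - ⟪f 1, f 1⟫_ℝ ∧
    2 * ⟪f 1, f 2⟫_ℝ = ⟪f 0, f 0⟫_ℝ - ⟪f 1, f 1⟫_ℝ - ⟪f 2, f 2⟫_ℝ ∧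
    2 * ⟪f 0, f 2⟫_ℝ = ⟪f 1, f 1⟫_ℝ - ⟪f 0, f 0⟫_ℝ - ⟪f 2, f 2⟫_ℝ := by
  have e : f 2 = -f 0 - f 1 := by
    rw [← sub_eq_zero, ← H.sum_eq_zero]
    abel
  rw [e]
  simp only [inner_sub_left, inner_sub_right, inner_neg_left, inner_neg_right,
    real_inner_comm (f 0) (f 1)]
  refine ⟨?_, ?_, ?_⟩ <;> ring

/-- If the even parts span a plane, then the odd parts are parallel, so that their Gram matrix has
rank one. For `k < 1` this leaves only the triangular prism. -/
theorem gram_even_eq (H : IsSplitHexagon k f h) (hk : k < 1)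
    (hW : ⟪f 0, f 0⟫_ℝ * ⟪f 1, f 1⟫_ℝ - ⟪f 0, f 1⟫_ℝ ^ 2 ≠ 0) :
    ⟪f 0, f 0⟫_ℝ * ⟪f 1, f 1⟫_ℝ - ⟪f 0, f 1⟫_ℝ ^ 2 = 12 * k ^ 2 := by
  set W := ⟪f 0, f 0⟫_ℝ * ⟪f 1, f 1⟫_ℝ - ⟪f 0, f 1⟫_ℝ ^ 2 with hWdef
  have key : ∀ i j, triple (h i) (f 0) (f 1) * triple (h j) (f 0) (f 1) = W * ⟪h i, h j⟫_ℝ := by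
    intro i j
    rw [triple_mul_triple, real_inner_comm, H.ortho, real_inner_comm, H.ortho, hWdef]
    ring
  obtain ⟨g01, g12, g02⟩ := H.inner_even
  have k00 := key 0 0
  have k11 := key 1 1
  have k22 := key 2 2
  have k01 := key 0 1
  have k12 := key 1 2
  have k02 := key 0 2
  rw [H.diag] at k00 k11 k22
  rw [H.cross 0 1 (by decide)] at k01
  rw [H.cross 1 2 (by decide)] at k12
  rw [H.cross 0 2 (by decide)] at k02
  generalize triple (h 0) (f 0) (f 1) = a at *
  generalize triple (h 1) (f 0) (f 1) = b at *
  generalize triple (h 2) (f 0) (f 1) = c at *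
  -- the pairwise products of `b + c - a`, `c + a - b` and `a + b - c` are equal and nonzero
  have e₀ : (b + c - a) * (c + a - b) = 4 * (1 - k) * W := by
    linear_combination 2 * k01 - k00 - k11 + k22 + W * g01
  have e₁ : (c + a - b) * (a + b - c) = 4 * (1 - k) * W := by
    linear_combination 2 * k12 + k00 - k11 - k22 + W * g12
  have e₂ : (b + c - a) * (a + b - c) = 4 * (1 - k) * W := by
    linear_combination 2 * k02 - k00 + k11 - k22 + W * g02
  have hne : 4 * (1 - k) * W ≠ 0 := mul_ne_zero (by linarith) hW
  have hab : a = b := by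
    have : (a + b - c) * (b - a) = 0 := by linear_combination (e₂ - e₁) / 2
    rcases mul_eq_zero.1 this with h' | h'
    · rw [h', mul_zero] at e₁
      exact absurd e₁.symm hne
    · linarith
  have hbc : b = c := by
    have : (b + c - a) * (c - b) = 0 := by linear_combination (e₀ - e₂) / 2
    rcases mul_eq_zero.1 this with h' | h'
    · rw [h', zero_mul] at e₀
      exact absurd e₀.symm hne
    · linarith
  subst hab hbc
  have F : ∀ x, a * a = W * (4 - x) → x = 4 * k := fun x hx =>
    mul_left_cancel₀ hW (by linear_combination hx - e₀)
  have F0 := F _ k00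
  have F1 := F _ k11
  have F2 := F _ k22
  have F01 : ⟪f 0, f 1⟫_ℝ = -2 * k := by linarith
  rw [hWdef, F0, F1, F01]
  ring

/-- If the even parts are not all zero and do not span a plane, then they are multiples of one unit
vector, which is orthogonal to all the odd parts. -/
theorem exists_axis (H : IsSplitHexagon k f h) (hf : ¬ ∀ i, f i = 0)
    (hW : ⟪f 0, f 0⟫_ℝ * ⟪f 1, f 1⟫_ℝ - ⟪f 0, f 1⟫_ℝ ^ 2 = 0) :
    ∃ (n : Space3) (φ : Fin 3 → ℝ), ⟪n, n⟫_ℝ = 1 ∧ (∀ i, f i = φ i • n) ∧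
      (∀ i, ⟪n, h i⟫_ℝ = 0) ∧ φ 2 = -φ 0 - φ 1 := by
  push Not at hf
  obtain ⟨j, hj⟩ := hf
  obtain ⟨g01, g12, g02⟩ := H.inner_even
  have hpos : 0 < ⟪f j, f j⟫_ℝ := real_inner_self_pos.2 hj
  have hW' : ∀ i, ⟪f i, f i⟫_ℝ * ⟪f j, f j⟫_ℝ - ⟪f i, f j⟫_ℝ ^ 2 = 0 := by
    intro i
    have s10 := real_inner_comm (f 0) (f 1)
    have s21 := real_inner_comm (f 1) (f 2)
    have s20 := real_inner_comm (f 0) (f 2)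
    have a01 : ⟪f 0, f 1⟫_ℝ = (⟪f 2, f 2⟫_ℝ - ⟪f 0, f 0⟫_ℝ - ⟪f 1, f 1⟫_ℝ) / 2 := by linarith
    have a12 : ⟪f 1, f 2⟫_ℝ = (⟪f 0, f 0⟫_ℝ - ⟪f 1, f 1⟫_ℝ - ⟪f 2, f 2⟫_ℝ) / 2 := by linarith
    have a02 : ⟪f 0, f 2⟫_ℝ = (⟪f 1, f 1⟫_ℝ - ⟪f 0, f 0⟫_ℝ - ⟪f 2, f 2⟫_ℝ) / 2 := by linarith
    rw [a01] at hW
    fin_cases i <;> fin_cases j <;>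
      simp only [Fin.zero_eta, Fin.mk_one, Fin.reduceFinMk, s10, s20, s21, a01, a12, a02] <;>
      linarith
  have hn : ‖f j‖ ^ 2 = ⟪f j, f j⟫_ℝ := (real_inner_self_eq_norm_sq _).symm
  have hn0 : ‖f j‖ ≠ 0 := norm_ne_zero_iff.2 hj
  have hφ : ∀ i, f i = (⟪f i, f j⟫_ℝ / ‖f j‖) • (‖f j‖⁻¹ • f j) := by
    intro i
    rw [smul_smul, ← sub_eq_zero, ← inner_self_eq_zero (𝕜 := ℝ)]
    simp only [inner_sub_left, inner_sub_right, inner_smul_left, inner_smul_right, conj_trivial,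
      real_inner_comm (f i) (f j)]
    have := hW' i
    rw [← hn] at this ⊢
    field_simp
    linarith
  refine ⟨‖f j‖⁻¹ • f j, fun i => ⟪f i, f j⟫_ℝ / ‖f j‖, ?_, hφ, ?_, ?_⟩
  · rw [inner_smul_left, inner_smul_right, ← hn, conj_trivial]
    field_simp
  · intro i
    rw [inner_smul_left, H.ortho, mul_zero]
  · have e : f 2 = -f 0 - f 1 := by
      rw [← sub_eq_zero, ← H.sum_eq_zero]
      abel
    simp only [e, inner_sub_left, inner_neg_left]
    ring

/-- The Gram matrix of the odd parts of a hexagon whose even parts are multiples of one unit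
vector. -/
theorem gram_odd (H : IsSplitHexagon k f h) {n : Space3} {φ : Fin 3 → ℝ} (hn : ⟪n, n⟫_ℝ = 1)
    (hφ : ∀ i, f i = φ i • n) :
    (∀ i, ⟪h i, h i⟫_ℝ = 4 - φ i ^ 2) ∧
      ∀ i j, i ≠ j → ⟪h i, h j⟫_ℝ = φ i * φ j + 4 - 2 * k := by
  constructor
  · intro i
    rw [H.diag, hφ, inner_smul_left, inner_smul_right, hn, conj_trivial]
    ring
  · intro i j hij
    rw [H.cross i j hij, hφ, hφ, inner_smul_left, inner_smul_right, hn, conj_trivial]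
    ring

/-- The determinant of the Gram matrix of the odd parts, which lie in a plane, vanishes. -/
theorem prod_sq_eq (H : IsSplitHexagon k f h) {n : Space3} {φ : Fin 3 → ℝ} (hn : ⟪n, n⟫_ℝ = 1)
    (hφ : ∀ i, f i = φ i • n) (hnh : ∀ i, ⟪n, h i⟫_ℝ = 0) (hs : φ 2 = -φ 0 - φ 1) :
    (φ 0 * φ 1 * φ 2) ^ 2 =
      2 * k * (φ 0 ^ 2 + φ 1 ^ 2 + φ 2 ^ 2) - 4 * k ^ 2 * (3 - k) := by
  have hD : triple (h 0) (h 1) (h 2) = 0 := by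
    by_contra hD
    rw [eq_zero_of_triple_ne_zero hD (hnh 0) (hnh 1) (hnh 2), inner_zero_left] at hn
    exact zero_ne_one hn
  have h2 := triple_sq (h 0) (h 1) (h 2)
  obtain ⟨g, g'⟩ := H.gram_odd hn hφ
  rw [hD, g, g, g, g' 0 1 (by decide), g' 1 2 (by decide), g' 0 2 (by decide), hs] at h2
  rw [hs]
  linear_combination -h2 / 4

/-- `2 k (6 k - ∑ φᵢ²)` is the square of an area in the plane of the odd parts. -/
theorem sum_sq_le (H : IsSplitHexagon k f h) {n : Space3} {φ : Fin 3 → ℝ} (hn : ⟪n, n⟫_ℝ = 1)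
    (hφ : ∀ i, f i = φ i • n) (hnh : ∀ i, ⟪n, h i⟫_ℝ = 0) (hs : φ 2 = -φ 0 - φ 1) (hk : 0 < k) :
    φ 0 ^ 2 + φ 1 ^ 2 + φ 2 ^ 2 ≤ 6 * k := by
  have h2 := triple_sq_of_orthogonal (a := h 1 - h 0) (b := h 2 - h 0) hn
    (by rw [inner_sub_right, hnh, hnh, sub_zero]) (by rw [inner_sub_right, hnh, hnh, sub_zero])
  obtain ⟨g, g'⟩ := H.gram_odd hn hφ
  simp only [inner_sub_left, inner_sub_right] at h2
  rw [g, g, g, g' 0 1 (by decide), g' 1 2 (by decide), g' 0 2 (by decide), g' 1 0 (by decide),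
    g' 2 0 (by decide), hs] at h2
  have h3 : triple n (h 1 - h 0) (h 2 - h 0) ^ 2 =
      2 * k * (6 * k - (φ 0 ^ 2 + φ 1 ^ 2 + φ 2 ^ 2)) := by
    rw [h2, hs]
    ring
  have h4 : 0 ≤ 2 * k * (6 * k - (φ 0 ^ 2 + φ 1 ^ 2 + φ 2 ^ 2)) := h3 ▸ sq_nonneg _
  have := nonneg_of_mul_nonneg_right h4 (by linarith)
  linarith

/-- For `k < 1` the chirality does not vanish on hexagons whose even parts span a line: its square
is a quadratic polynomial in `∑ φᵢ²`, positive up to the bound `6 k` of `sum_sq_le`. -/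
theorem twist_ne_zero (H : IsSplitHexagon k f h) (hk₀ : 0 < k) (hk₁ : k < 1)
    (hf : ¬ ∀ i, f i = 0)
    (hW : ⟪f 0, f 0⟫_ℝ * ⟪f 1, f 1⟫_ℝ - ⟪f 0, f 1⟫_ℝ ^ 2 = 0) : twist f h ≠ 0 := by
  obtain ⟨n, φ, hn, hφ, hnh, hs⟩ := H.exists_axis hf hW
  have hπ := H.prod_sq_eq hn hφ hnh hs
  have hρ := H.sum_sq_le hn hφ hnh hs hk₀
  obtain ⟨g, g'⟩ := H.gram_odd hn hφ
  have ht : twist f h = triple n (φ 0 • h 0 + φ 1 • h 1 + φ 2 • h 2) (h 0 + h 1 + h 2) := by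
    simp only [twist, hφ, triple_smul_left]
    simp only [triple, PiLp.add_apply, PiLp.smul_apply, smul_eq_mul]
    ring
  have h2 := triple_sq_of_orthogonal (a := φ 0 • h 0 + φ 1 • h 1 + φ 2 • h 2)
    (b := h 0 + h 1 + h 2) hn
    (by simp only [inner_add_right, inner_smul_right, hnh]; ring)
    (by simp only [inner_add_right, hnh]; ring)
  simp only [inner_add_left, inner_add_right, inner_smul_left, inner_smul_right,
    conj_trivial] at h2
  rw [g, g, g, g' 0 1 (by decide), g' 1 2 (by decide), g' 0 2 (by decide), g' 1 0 (by decide),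
    g' 2 1 (by decide), g' 2 0 (by decide), ← ht] at h2
  set ρ := φ 0 ^ 2 + φ 1 ^ 2 + φ 2 ^ 2 with hρdef
  have h3 : twist f h ^ 2 = 4 * k * (36 * k * (3 - k) - 6 * k * ρ - ρ ^ 2) := by
    rw [hρdef] at hπ ⊢
    rw [h2]
    rw [hs] at hπ ⊢
    linear_combination -36 * hπ
  have hρ₀ : 0 ≤ ρ := by positivity
  have h4 : 0 < twist f h ^ 2 := by
    rw [h3]
    have : 0 < 36 * k * (3 - k) - 6 * k * ρ - ρ ^ 2 := by nlinarith
    positivity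
  intro h0
  rw [h0] at h4
  norm_num at h4

end IsSplitHexagon

/-! ### Continuous functions on the configuration space -/

theorem evenPart_map (g : Space3 ≃ᵃⁱ[ℝ] Space3) (P : Fin 6 → Space3) (i : Fin 3) :
    evenPart (fun j => g (P j)) i = g.linearIsometryEquiv (evenPart P i) := by
  have he : ∀ j, edge (fun j => g (P j)) j = g.linearIsometryEquiv (edge P j) := fun j =>
    (g.map_vsub _ _).symm
  fin_cases i <;> simp [evenPart, he]

theorem oddPart_map (g : Space3 ≃ᵃⁱ[ℝ] Space3) (P : Fin 6 → Space3) (i : Fin 3) :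
    oddPart (fun j => g (P j)) i = g.linearIsometryEquiv (oddPart P i) := by
  have he : ∀ j, edge (fun j => g (P j)) j = g.linearIsometryEquiv (edge P j) := fun j =>
    (g.map_vsub _ _).symm
  fin_cases i <;> simp [oddPart, he]

theorem continuous_evenPart (i : Fin 3) : Continuous fun P : Fin 6 → Space3 => evenPart P i := by
  fin_cases i <;> simp [evenPart, edge] <;> fun_prop

theorem continuous_oddPart (i : Fin 3) : Continuous fun P : Fin 6 → Space3 => oddPart P i := by
  fin_cases i <;> simp [oddPart, edge] <;> fun_prop

theorem Continuous.triple {X : Type*} [TopologicalSpace X] {a b c : X → Space3}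
    (ha : Continuous a) (hb : Continuous b) (hc : Continuous c) :
    Continuous fun x => triple (a x) (b x) (c x) := by
  unfold _root_.triple
  fun_prop

/-- A rotation invariant continuous function of the even and odd parts of a hexagon is a
continuous function on the configuration space. -/
theorem exists_continuous_config {θ : ℝ} (u : (Fin 3 → Space3) → (Fin 3 → Space3) → ℝ)
    (hu : Continuous fun P : Fin 6 → Space3 => u (evenPart P) (oddPart P))
    (hinv : ∀ L : Space3 ≃ₗᵢ[ℝ] Space3,
      LinearMap.det (L.toLinearEquiv : Space3 →ₗ[ℝ] Space3) = 1 →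
      ∀ f h, u (fun i => L (f i)) (fun i => L (h i)) = u f h) :
    ∃ U : ConfigurationSpace 6 θ → ℝ, Continuous U ∧
      ∀ P : EquiangularPolygon 6 θ, U P.toConfig = u (evenPart P.1) (oddPart P.1) := by
  refine ⟨Quotient.lift (fun P => u (evenPart P.1) (oddPart P.1)) ?_, ?_, fun P => rfl⟩
  · rintro P Q ⟨g, hg, hPQ⟩
    have hQ : Q.1 = fun i => g (P.1 i) := funext fun i => (hPQ i).symm
    rw [hQ, funext (evenPart_map g P.1), funext (oddPart_map g P.1),
      hinv _ (det_eq_one_of_pos _ hg)]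
  · exact (hu.comp continuous_subtype_val).quotient_lift _

/-- The squared volume spanned by the odd parts, as a function on the configuration space. -/
theorem exists_volume_config (θ : ℝ) :
    ∃ U : ConfigurationSpace 6 θ → ℝ, Continuous U ∧ ∀ P : EquiangularPolygon 6 θ,
      U P.toConfig = triple (oddPart P.1 0) (oddPart P.1 1) (oddPart P.1 2) ^ 2 :=
  exists_continuous_config (fun _ h => triple (h 0) (h 1) (h 2) ^ 2)
    (((continuous_oddPart 0).triple (continuous_oddPart 1) (continuous_oddPart 2)).pow 2)
    fun L hL f h => by rw [triple_map, hL, one_mul]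

/-- The Gram determinant of two even parts, as a function on the configuration space. -/
theorem exists_gram_config (θ : ℝ) :
    ∃ U : ConfigurationSpace 6 θ → ℝ, Continuous U ∧ ∀ P : EquiangularPolygon 6 θ,
      U P.toConfig = ⟪evenPart P.1 0, evenPart P.1 0⟫_ℝ * ⟪evenPart P.1 1, evenPart P.1 1⟫_ℝ
        - ⟪evenPart P.1 0, evenPart P.1 1⟫_ℝ ^ 2 :=
  exists_continuous_config
    (fun f _ => ⟪f 0, f 0⟫_ℝ * ⟪f 1, f 1⟫_ℝ - ⟪f 0, f 1⟫_ℝ ^ 2)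
    ((((continuous_evenPart 0).inner (continuous_evenPart 0)).mul
      ((continuous_evenPart 1).inner (continuous_evenPart 1))).sub
      (((continuous_evenPart 0).inner (continuous_evenPart 1)).pow 2))
    fun L hL f h => by simp only [LinearIsometryEquiv.inner_map_map]

theorem twist_map (L : Space3 ≃ₗᵢ[ℝ] Space3) (f h : Fin 3 → Space3) :
    twist (fun i => L (f i)) (fun i => L (h i)) =
      LinearMap.det (L.toLinearEquiv : Space3 →ₗ[ℝ] Space3) * twist f h := by
  simp only [twist, ← map_add, triple_map]
  ring

/-- The chirality, as a function on the configuration space. -/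
theorem exists_twist_config (θ : ℝ) :
    ∃ U : ConfigurationSpace 6 θ → ℝ, Continuous U ∧ ∀ P : EquiangularPolygon 6 θ,
      U P.toConfig = twist (evenPart P.1) (oddPart P.1) := by
  refine exists_continuous_config twist ?_ fun L hL f h => by rw [twist_map, hL, one_mul]
  have hs := ((continuous_oddPart 0).add (continuous_oddPart 1)).add (continuous_oddPart 2)
  exact (((continuous_evenPart 0).triple (continuous_oddPart 0) hs).add
    ((continuous_evenPart 1).triple (continuous_oddPart 1) hs)).add
    ((continuous_evenPart 2).triple (continuous_oddPart 2) hs)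

theorem twist_mirror {θ : ℝ} (P : EquiangularPolygon 6 θ) :
    twist (evenPart P.mirror.1) (oddPart P.mirror.1) =
      -twist (evenPart P.1) (oddPart P.1) := by
  have h₁ := funext (evenPart_map horizontalReflection.toAffineIsometryEquiv P.1)
  have h₂ := funext (oddPart_map horizontalReflection.toAffineIsometryEquiv P.1)
  have h := twist_map horizontalReflection (evenPart P.1) (oddPart P.1)
  rw [det_horizontalReflection, neg_one_mul] at h
  rw [← h]
  exact congrArg₂ twist h₁ h₂

theorem Joined.eq_zero_of_two_valued {X : Type*} [TopologicalSpace X] {x y : X} (hxy : Joined x y)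
    {u : X → ℝ} (hu : Continuous u) {c : ℝ} (hc : 0 < c) (h : ∀ z, u z = 0 ∨ u z = c)
    (hx : u x = 0) : u y = 0 := by
  refine (h y).resolve_right fun hy => ?_
  obtain ⟨z, -, hz⟩ := (isPathConnected_pathComponent (x := x)).isConnected.isPreconnected
    |>.intermediate_value (mem_pathComponent_self x) hxy hu.continuousOn
    (show c / 2 ∈ Set.Icc (u x) (u y) by rw [hx, hy]; constructor <;> linarith)
  rcases h z with h' | h' <;> linarith

/-! ### Boats and chairs -/

/-- A hexagon with its labels shifted by `j`. -/
def EquiangularPolygon.relabel {θ : ℝ} (P : EquiangularPolygon 6 θ) (j : Fin 6) :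
    EquiangularPolygon 6 θ :=
  ⟨fun i => P.1 (i + j), fun i => by
    have h := P.2 (i + j)
    beta_reduce
    rw [add_right_comm, sub_add_eq_add_sub i 1 j]
    exact h⟩

theorem hasParallelogram_relabel {θ : ℝ} (P : EquiangularPolygon 6 θ) (i : Fin 6) :
    HasParallelogram (P.relabel i).1 0 ↔ HasParallelogram P.1 i := by
  simp only [HasParallelogram, EquiangularPolygon.relabel, zero_sub, zero_add,
    add_comm _ i, ← sub_eq_add_neg]

theorem basePlane_relabel {θ : ℝ} (P : EquiangularPolygon 6 θ) (i : Fin 6) :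
    basePlane (P.relabel i).1 0 = basePlane P.1 i := by
  simp only [basePlane, EquiangularPolygon.relabel, zero_sub, zero_add,
    add_comm _ i, ← sub_eq_add_neg]

theorem evenPart_one_of_hasParallelogram {P : Fin 6 → Space3} (h : HasParallelogram P 0) :
    evenPart P 1 = 0 := by
  have h' : P 4 - P 5 = P 2 - P 1 := h
  have : edge P 4 + edge P 1 = P 5 - P 4 + (P 2 - P 1) := rfl
  change edge P 4 + edge P 1 = 0
  rw [this, ← h']
  abel

/-- If `e₀ + e₃ = 0`, then `P 0` and `P 3` are symmetric about the midpoint of `P 1` and `P 4`,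
hence on opposite sides of the base plane. -/
theorem evenPart_zero_ne_zero_of_sSameSide {P : Fin 6 → Space3}
    (h : (basePlane P 0).SSameSide (P 0) (P 3)) : evenPart P 0 ≠ 0 := by
  intro h0
  have h0' : (P 1 - P 0) + (P 4 - P 3) = 0 := h0
  have hmem : midpoint ℝ (P 1) (P 4) ∈ basePlane P 0 := by
    refine AffineMap.lineMap_mem _ ?_ ?_
    · exact subset_affineSpan ℝ _ (by right; left; rfl)
    · exact subset_affineSpan ℝ _ (by right; right; right; rfl)
  have h3 : AffineEquiv.pointReflection ℝ (midpoint ℝ (P 1) (P 4)) (P 0) = P 3 := by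
    rw [AffineEquiv.pointReflection_apply, midpoint_eq_smul_add, vsub_eq_sub, vadd_eq_add,
      invOf_eq_inv, ← sub_eq_zero, ← h0']
    module
  have := AffineSubspace.sOppSide_pointReflection hmem h.2.1
  rw [h3] at this
  exact h.not_sOppSide this

/-- When one even part vanishes, the other ones are normal to the base plane. -/
theorem inner_eq_of_mem_basePlane {P : Fin 6 → Space3} {k : ℝ}
    (H : IsSplitHexagon k (evenPart P) (oddPart P)) (h1 : evenPart P 1 = 0) {x : Space3}
    (hx : x ∈ basePlane P 0) : ⟪evenPart P 0, x⟫_ℝ = ⟪evenPart P 0, P 1⟫_ℝ := by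
  have o0 : ⟪evenPart P 0, edge P 0 - edge P 3⟫_ℝ = 0 := H.ortho 0 0
  have o1 : ⟪evenPart P 0, edge P 4 - edge P 1⟫_ℝ = 0 := H.ortho 0 1
  have o2 : ⟪evenPart P 0, edge P 2 - edge P 5⟫_ℝ = 0 := H.ortho 0 2
  have z1 : ⟪evenPart P 0, edge P 4 + edge P 1⟫_ℝ = 0 := by
    rw [show edge P 4 + edge P 1 = 0 from h1, inner_zero_right]
  have z2 : ⟪evenPart P 0, evenPart P 0 + evenPart P 1 + evenPart P 2⟫_ℝ = 0 := by
    rw [H.sum_eq_zero, inner_zero_right]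
  rw [h1, add_zero] at z2
  rw [show evenPart P 0 + evenPart P 2 =
    edge P 0 + edge P 3 + (edge P 2 + edge P 5) from rfl] at z2
  simp only [edge, inner_add_right, inner_sub_right] at o0 o1 o2 z1 z2
  change ⟪evenPart P 0, P 1⟫_ℝ - ⟪evenPart P 0, P 0⟫_ℝ -
    (⟪evenPart P 0, P 4⟫_ℝ - ⟪evenPart P 0, P 3⟫_ℝ) = 0 at o0
  change ⟪evenPart P 0, P 5⟫_ℝ - ⟪evenPart P 0, P 4⟫_ℝ -
    (⟪evenPart P 0, P 2⟫_ℝ - ⟪evenPart P 0, P 1⟫_ℝ) = 0 at o1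
  change ⟪evenPart P 0, P 3⟫_ℝ - ⟪evenPart P 0, P 2⟫_ℝ -
    (⟪evenPart P 0, P 0⟫_ℝ - ⟪evenPart P 0, P 5⟫_ℝ) = 0 at o2
  change ⟪evenPart P 0, P 5⟫_ℝ - ⟪evenPart P 0, P 4⟫_ℝ +
    (⟪evenPart P 0, P 2⟫_ℝ - ⟪evenPart P 0, P 1⟫_ℝ) = 0 at z1
  change ⟪evenPart P 0, P 1⟫_ℝ - ⟪evenPart P 0, P 0⟫_ℝ +
    (⟪evenPart P 0, P 4⟫_ℝ - ⟪evenPart P 0, P 3⟫_ℝ) +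
    (⟪evenPart P 0, P 3⟫_ℝ - ⟪evenPart P 0, P 2⟫_ℝ +
    (⟪evenPart P 0, P 0⟫_ℝ - ⟪evenPart P 0, P 5⟫_ℝ)) = 0 at z2
  refine affineSpan_induction hx ?_ ?_
  · rintro y (rfl | rfl | rfl | rfl)
    · change ⟪evenPart P 0, P 5⟫_ℝ = _
      linarith
    · rfl
    · change ⟪evenPart P 0, P 2⟫_ℝ = _
      linarith
    · change ⟪evenPart P 0, P 4⟫_ℝ = _
      linarith
  · intro c u v w hu hv hw
    rw [vadd_eq_add, vsub_eq_sub, inner_add_right, inner_smul_right, inner_sub_right, hu, hv, hw]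
    ring

/-- If `P 1, P 2, P 4, P 5` form a parallelogram and `P 0`, `P 3` lie on opposite sides of it,
the hexagon is centrally symmetric: otherwise the nonzero even part would be normal to the
parallelogram, and `P 0` and `P 3` would have the same height above it. -/
theorem evenPart_zero_eq_zero_of_sOppSide {P : Fin 6 → Space3} {k : ℝ}
    (H : IsSplitHexagon k (evenPart P) (oddPart P)) (h1 : evenPart P 1 = 0)
    (h : (basePlane P 0).SOppSide (P 0) (P 3)) : evenPart P 0 = 0 := by
  by_contra h0
  obtain ⟨p, hp, q, hq, hr⟩ := h.1
  have hpos : 0 < ⟪evenPart P 0, evenPart P 0⟫_ℝ := real_inner_self_pos.2 h0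
  have hp' := inner_eq_of_mem_basePlane H h1 hp
  have hq' := inner_eq_of_mem_basePlane H h1 hq
  have h4 := inner_eq_of_mem_basePlane H h1 (x := P 4)
    (subset_affineSpan ℝ _ (by right; right; right; rfl))
  have hs : ⟪evenPart P 0, edge P 0 + edge P 3⟫_ℝ = ⟪evenPart P 0, evenPart P 0⟫_ℝ := rfl
  have ho : ⟪evenPart P 0, edge P 0 - edge P 3⟫_ℝ = 0 := H.ortho 0 0
  have e0 : edge P 0 = P 1 - P 0 := rfl
  have e3 : edge P 3 = P 4 - P 3 := rfl
  simp only [e0, e3, inner_add_right, inner_sub_right] at hs ho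
  have hx : ⟪evenPart P 0, P 0 - p⟫_ℝ < 0 := by
    rw [inner_sub_right]
    linarith
  have hy : 0 < ⟪evenPart P 0, q - P 3⟫_ℝ := by
    rw [inner_sub_right]
    linarith
  rcases hr with hr | hr | ⟨r, s, hr0, hs0, hr⟩
  · rw [vsub_eq_sub] at hr
    rw [hr, inner_zero_right] at hx
    exact lt_irrefl _ hx
  · rw [vsub_eq_sub] at hr
    rw [hr, inner_zero_right] at hy
    exact lt_irrefl _ hy
  · have := congrArg (fun v => ⟪evenPart P 0, v⟫_ℝ) hr
    simp only [inner_smul_right, vsub_eq_sub] at this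
    nlinarith [mul_pos hs0 hy, mul_pos hr0 (neg_pos.2 hx)]

theorem evenPart_eq_zero_iff (P : Fin 6 → Space3) :
    (∀ j, evenPart P j = 0) ↔ ∀ i, edge P i + edge P (i + 3) = 0 := by
  have c0 : ∀ x y : Space3, x + y = 0 ↔ y + x = 0 := fun x y => by rw [add_comm]
  constructor
  · intro h i
    have h0 : edge P 0 + edge P 3 = 0 := h 0
    have h1 : edge P 4 + edge P 1 = 0 := h 1
    have h2 : edge P 2 + edge P 5 = 0 := h 2
    fin_cases i
    · exact h0
    · exact (c0 _ _).1 h1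
    · exact h2
    · exact (c0 _ _).1 h0
    · exact h1
    · exact (c0 _ _).1 h2
  · intro h j
    fin_cases j
    · exact h 0
    · exact h 4
    · exact h 2

theorem edge_relabel {θ : ℝ} (P : EquiangularPolygon 6 θ) (j i : Fin 6) :
    edge (P.relabel j).1 i = edge P.1 (i + j) := by
  simp only [edge, EquiangularPolygon.relabel, add_right_comm]

theorem evenPart_relabel_eq_zero_iff {θ : ℝ} (P : EquiangularPolygon 6 θ) (j : Fin 6) :
    (∀ i, evenPart (P.relabel j).1 i = 0) ↔ ∀ i, evenPart P.1 i = 0 := by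
  simp only [evenPart_eq_zero_iff, edge_relabel]
  constructor
  · intro h i
    have := h (i - j)
    rwa [sub_add_cancel, add_right_comm, sub_add_cancel] at this
  · intro h i
    have := h (i + j)
    rwa [add_right_comm] at this

theorem EquiangularPolygon.isSplitHexagon {θ : ℝ} (hθ₀ : 0 ≤ θ) (hθπ : θ ≤ π)
    (P : EquiangularPolygon 6 θ) :
    IsSplitHexagon (2 - 2 * cos θ) (evenPart P.1) (oddPart P.1) :=
  isSplitHexagon_of_isEquiangularUnitPolygon hθ₀ hθπ P.2

/-- Chairs are centrally symmetric. -/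
theorem EquiangularPolygon.IsChair.evenPart_eq_zero {θ : ℝ} (hθ₀ : 0 ≤ θ) (hθπ : θ ≤ π)
    {P : EquiangularPolygon 6 θ} (h : P.IsChair) :
    ∀ i, evenPart P.1 i = 0 := by
  obtain ⟨i, hi, hs⟩ := h
  rw [← evenPart_relabel_eq_zero_iff P i]
  have H := (P.relabel i).isSplitHexagon hθ₀ hθπ
  have h1 := evenPart_one_of_hasParallelogram ((hasParallelogram_relabel P i).2 hi)
  rw [← basePlane_relabel] at hs
  have h0 := evenPart_zero_eq_zero_of_sOppSide H h1 (by
    simpa only [EquiangularPolygon.relabel, zero_add, add_comm i] using hs)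
  have h2 := H.sum_eq_zero
  rw [h0, h1, zero_add, zero_add] at h2
  intro j
  fin_cases j
  exacts [h0, h1, h2]

/-- After a shift of the labels, exactly the even part with index `1` of a boat vanishes. -/
theorem EquiangularPolygon.IsBoat.exists_relabel {θ : ℝ} {P : EquiangularPolygon 6 θ}
    (h : P.IsBoat) :
    ∃ i, evenPart (P.relabel i).1 1 = 0 ∧ evenPart (P.relabel i).1 0 ≠ 0 := by
  obtain ⟨i, hi, hs⟩ := h
  refine ⟨i, evenPart_one_of_hasParallelogram ((hasParallelogram_relabel P i).2 hi), ?_⟩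
  rw [← basePlane_relabel] at hs
  exact evenPart_zero_ne_zero_of_sSameSide (by
    simpa only [EquiangularPolygon.relabel, zero_add, add_comm i] using hs)

theorem EquiangularPolygon.IsBoat.not_evenPart_eq_zero {θ : ℝ} {P : EquiangularPolygon 6 θ}
    (h : P.IsBoat) : ¬ ∀ i, evenPart P.1 i = 0 := by
  obtain ⟨i, -, hi⟩ := h.exists_relabel
  rw [← evenPart_relabel_eq_zero_iff P i]
  exact fun h' => hi (h' 0)

theorem EquiangularPolygon.IsBoat.exists_evenPart_eq_zero {θ : ℝ} {P : EquiangularPolygon 6 θ}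
    (h : P.IsBoat) : ∃ i, evenPart P.1 i = 0 := by
  obtain ⟨i, hi, -⟩ := h.exists_relabel
  have h' : edge P.1 (4 + i) + edge P.1 (1 + i) = 0 := by
    rw [← edge_relabel, ← edge_relabel]
    exact hi
  fin_cases i
  · exact ⟨1, h'⟩
  · exact ⟨2, (add_comm _ _).trans h'⟩
  · exact ⟨0, h'⟩
  · exact ⟨1, (add_comm _ _).trans h'⟩
  · exact ⟨2, h'⟩
  · exact ⟨0, (add_comm _ _).trans h'⟩

namespace IsSplitHexagon

variable {k : ℝ} {f h : Fin 3 → Space3}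

theorem gram_even_eq_zero (H : IsSplitHexagon k f h) (hf : ∃ i, f i = 0) :
    ⟪f 0, f 0⟫_ℝ * ⟪f 1, f 1⟫_ℝ - ⟪f 0, f 1⟫_ℝ ^ 2 = 0 := by
  obtain ⟨i, hi⟩ := hf
  obtain ⟨g01, g12, g02⟩ := H.inner_even
  fin_cases i
  · change f 0 = 0 at hi
    simp [hi]
  · change f 1 = 0 at hi
    simp [hi]
  · change f 2 = 0 at hi
    rw [hi, inner_zero_right, inner_zero_right, mul_zero] at g12
    rw [hi, inner_zero_right] at g01
    have h1 : ⟪f 0, f 0⟫_ℝ = ⟪f 1, f 1⟫_ℝ := by linarith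
    have h2 : ⟪f 0, f 1⟫_ℝ = -⟪f 1, f 1⟫_ℝ := by linarith
    rw [h1, h2]
    ring

/-- If exactly one even part vanishes, as for a boat, the norm of the other two is determined by the
angle, and the angle is not zero. -/
theorem even_sq_eq (H : IsSplitHexagon k f h) (hk : 0 ≤ k) (h1 : f 1 = 0) (h0 : f 0 ≠ 0) :
    0 < k ∧ ⟪f 0, f 0⟫_ℝ = k * (3 - k) := by
  obtain ⟨n, φ, hn, hφ, hnh, hs⟩ := H.exists_axis (fun hf => h0 (hf 0))
    (H.gram_even_eq_zero ⟨1, h1⟩)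
  have hn0 : n ≠ 0 := by
    rintro rfl
    simp at hn
  have hφ1 : φ 1 = 0 := (smul_eq_zero.1 ((hφ 1).symm.trans h1)).resolve_right hn0
  have hφ0 : φ 0 ≠ 0 := fun hc => h0 (by rw [hφ, hc, zero_smul])
  have hf0 : ⟪f 0, f 0⟫_ℝ = φ 0 ^ 2 := by
    rw [hφ, inner_smul_left, inner_smul_right, hn, conj_trivial]
    ring
  have hπ := H.prod_sq_eq hn hφ hnh hs
  rw [hs, hφ1] at hπ
  have hk0 : k ≠ 0 := by
    rintro rfl
    obtain ⟨g, g'⟩ := H.gram_odd hn hφ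
    -- for `k = 0` the Cauchy–Schwarz inequality for `h 0` and `h 1` forces `φ 0 = 0`
    have h2 := triple_sq_of_orthogonal hn (hnh 0) (hnh 1)
    rw [g, g, g' 0 1 (by decide), hφ1] at h2
    have : φ 0 ^ 2 ≤ 0 := by nlinarith [sq_nonneg (triple n (h 0) (h 1))]
    exact hφ0 (pow_eq_zero_iff two_ne_zero |>.1 (le_antisymm this (sq_nonneg _)))
  refine ⟨lt_of_le_of_ne hk hk0.symm, ?_⟩
  rw [hf0]
  exact mul_left_cancel₀ hk0 (by linear_combination -hπ / 4)

end IsSplitHexagon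

/-- Boats only exist for angles strictly between `0` and `2π / 3`. -/
theorem EquiangularPolygon.IsBoat.param_mem {θ : ℝ} (hθ₀ : 0 ≤ θ) (hθπ : θ ≤ π)
    {P : EquiangularPolygon 6 θ} (h : P.IsBoat) :
    0 < 2 - 2 * cos θ ∧ 2 - 2 * cos θ < 3 := by
  obtain ⟨i, h1, h0⟩ := h.exists_relabel
  obtain ⟨hk, he⟩ := ((P.relabel i).isSplitHexagon hθ₀ hθπ).even_sq_eq
    (by linarith [cos_le_one θ]) h1 h0
  refine ⟨hk, ?_⟩
  have := real_inner_self_pos.2 h0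
  rw [he] at this
  linarith [pos_of_mul_pos_right this hk.le]

theorem EquiangularPolygon.IsBoat.volume_eq_zero {θ : ℝ} (hθ₀ : 0 ≤ θ) (hθπ : θ ≤ π)
    {P : EquiangularPolygon 6 θ} (h : P.IsBoat) :
    triple (oddPart P.1 0) (oddPart P.1 1) (oddPart P.1 2) = 0 := by
  by_contra hD
  exact h.not_evenPart_eq_zero ((P.isSplitHexagon hθ₀ hθπ).even_eq_zero_of_triple_ne_zero hD)

/-- Boats and chairs lie in different path components. -/
theorem not_joined_boat_chair {θ : ℝ} (hθ₀ : 0 ≤ θ) (hθπ : θ ≤ π) {B K : EquiangularPolygon 6 θ}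
    (hB : B.IsBoat) (hK : K.IsChair) : ¬ Joined B.toConfig K.toConfig := by
  intro hj
  obtain ⟨U, hU, hUP⟩ := exists_volume_config θ
  obtain ⟨hk₀, hk₃⟩ := hB.param_mem hθ₀ hθπ
  have hc : 0 < 16 * (2 - 2 * cos θ) ^ 2 * (3 - (2 - 2 * cos θ)) :=
    mul_pos (by positivity) (by linarith)
  have h0 := hj.eq_zero_of_two_valued hU hc ?_ ?_
  · rw [hUP, (K.isSplitHexagon hθ₀ hθπ).triple_sq_of_even_eq_zero
      (hK.evenPart_eq_zero hθ₀ hθπ)] at h0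
    exact hc.ne' h0
  · intro z
    obtain ⟨P, rfl⟩ := Quotient.exists_rep z
    exact (hUP P).symm ▸ (P.isSplitHexagon hθ₀ hθπ).triple_sq_eq_zero_or
  · rw [hUP, hB.volume_eq_zero hθ₀ hθπ]
    ring

/-- For angles below `π / 3` the chirality separates a boat from its mirror image. -/
theorem not_joined_boat_mirror {θ : ℝ} (hθ₀ : 0 ≤ θ) (hθπ : θ ≤ π) (hk : 2 - 2 * cos θ < 1)
    {B : EquiangularPolygon 6 θ} (hB : B.IsBoat) : ¬ Joined B.toConfig B.mirror.toConfig := by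
  intro hj
  obtain ⟨U, hU, hUP⟩ := exists_volume_config θ
  obtain ⟨V, hV, hVP⟩ := exists_gram_config θ
  obtain ⟨T, hT, hTP⟩ := exists_twist_config θ
  obtain ⟨hk₀, -⟩ := hB.param_mem hθ₀ hθπ
  have hc : 0 < 16 * (2 - 2 * cos θ) ^ 2 * (3 - (2 - 2 * cos θ)) :=
    mul_pos (by positivity) (by linarith)
  -- the volume and the Gram determinant are locally constant, so that they vanish on the whole path
  -- component of the boat
  have hne : ∀ z, Joined B.toConfig z → T z ≠ 0 := by
    intro z hz
    obtain ⟨P, rfl⟩ := Quotient.exists_rep z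
    have HP := P.isSplitHexagon hθ₀ hθπ
    have hU0 : U P.toConfig = 0 := by
      refine Joined.eq_zero_of_two_valued hz hU hc (fun z => ?_) ?_
      · obtain ⟨Q, rfl⟩ := Quotient.exists_rep z
        exact (hUP Q).symm ▸ (Q.isSplitHexagon hθ₀ hθπ).triple_sq_eq_zero_or
      · rw [hUP, hB.volume_eq_zero hθ₀ hθπ]
        ring
    have hV0 : V P.toConfig = 0 := by
      refine Joined.eq_zero_of_two_valued hz hV
        (show 0 < 12 * (2 - 2 * cos θ) ^ 2 by positivity) (fun z => ?_) ?_
      · obtain ⟨Q, rfl⟩ := Quotient.exists_rep z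
        have hQ := (Q.isSplitHexagon hθ₀ hθπ).gram_even_eq hk
        rw [← hVP] at hQ
        exact or_iff_not_imp_left.2 hQ
      · rw [hVP]
        exact (B.isSplitHexagon hθ₀ hθπ).gram_even_eq_zero hB.exists_evenPart_eq_zero
    have := HP.twist_ne_zero hk₀ hk (fun hf => hc.ne' (by
      rw [← HP.triple_sq_of_even_eq_zero hf, ← hUP, hU0])) (by rw [← hVP, hV0])
    rwa [← hTP] at this
  -- a continuous function without zeros does not change sign on a connected set
  have hm : T B.mirror.toConfig = -T B.toConfig := by rw [hTP, hTP, twist_mirror]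
  have hpre := (isPathConnected_pathComponent (x := B.toConfig)).isConnected.isPreconnected
  rcases le_total (T B.toConfig) 0 with h | h
  · obtain ⟨z, hz, hz0⟩ := hpre.intermediate_value (mem_pathComponent_self _) hj hT.continuousOn
      (show (0 : ℝ) ∈ Set.Icc _ _ from ⟨h, by linarith⟩)
    exact hne z hz hz0
  · obtain ⟨z, hz, hz0⟩ := hpre.intermediate_value hj (mem_pathComponent_self _) hT.continuousOn
      (show (0 : ℝ) ∈ Set.Icc _ _ from ⟨by linarith, h⟩)
    exact hne z hz hz0

/-! ### Hexagons with prescribed even and odd parts -/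

/-- The hexagon with first vertex `A` and given even and odd parts. -/
noncomputable def hexagonOfParts (A : Space3) (f h : Fin 3 → Space3) : Fin 6 → Space3 :=
  ![A,
    A + (1 / 2 : ℝ) • (f 0 + h 0),
    A + (1 / 2 : ℝ) • (f 0 + h 0 + (f 1 - h 1)),
    A + (1 / 2 : ℝ) • (f 0 + h 0 + (f 1 - h 1) + (f 2 + h 2)),
    A + (1 / 2 : ℝ) • (f 0 + h 0 + (f 1 - h 1) + (f 2 + h 2) + (f 0 - h 0)),
    A + (1 / 2 : ℝ) • (f 0 + h 0 + (f 1 - h 1) + (f 2 + h 2) + (f 0 - h 0) + (f 1 + h 1))]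

theorem hexagonOfParts_evenPart_oddPart (P : Fin 6 → Space3) :
    hexagonOfParts (P 0) (evenPart P) (oddPart P) = P := by
  funext i
  fin_cases i <;>
    simp [hexagonOfParts, evenPart, oddPart, edge, show (5 : Fin 6) + 1 = 0 from rfl] <;> module

theorem isEquiangularUnitPolygon_hexagonOfParts {θ : ℝ} (hθ₀ : 0 ≤ θ) (hθπ : θ ≤ π)
    {f h : Fin 3 → Space3} (H : IsSplitHexagon (2 - 2 * cos θ) f h) (A : Space3) :
    IsEquiangularUnitPolygon 6 θ (hexagonOfParts A f h) := by
  rw [isEquiangularUnitPolygon_iff_edge hθ₀ hθπ]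
  have hs := H.sum_eq_zero
  set P := hexagonOfParts A f h with hP
  have e0 : edge P 0 = (1 / 2 : ℝ) • (f 0 + h 0) := by
    change A + (1 / 2 : ℝ) • (f 0 + h 0) - A = _
    module
  have e1 : edge P 1 = (1 / 2 : ℝ) • (f 1 - h 1) := by
    change A + (1 / 2 : ℝ) • (f 0 + h 0 + (f 1 - h 1)) - (A + (1 / 2 : ℝ) • (f 0 + h 0)) = _
    module
  have e2 : edge P 2 = (1 / 2 : ℝ) • (f 2 + h 2) := by
    change A + (1 / 2 : ℝ) • (f 0 + h 0 + (f 1 - h 1) + (f 2 + h 2)) -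
      (A + (1 / 2 : ℝ) • (f 0 + h 0 + (f 1 - h 1))) = _
    module
  have e3 : edge P 3 = (1 / 2 : ℝ) • (f 0 - h 0) := by
    change A + (1 / 2 : ℝ) • (f 0 + h 0 + (f 1 - h 1) + (f 2 + h 2) + (f 0 - h 0)) -
      (A + (1 / 2 : ℝ) • (f 0 + h 0 + (f 1 - h 1) + (f 2 + h 2))) = _
    module
  have e4 : edge P 4 = (1 / 2 : ℝ) • (f 1 + h 1) := by
    change A + (1 / 2 : ℝ) • (f 0 + h 0 + (f 1 - h 1) + (f 2 + h 2) + (f 0 - h 0) +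
        (f 1 + h 1)) -
      (A + (1 / 2 : ℝ) • (f 0 + h 0 + (f 1 - h 1) + (f 2 + h 2) + (f 0 - h 0))) = _
    module
  have e5 : edge P 5 = (1 / 2 : ℝ) • (f 2 - h 2) := by
    change A - (A + (1 / 2 : ℝ) • (f 0 + h 0 + (f 1 - h 1) + (f 2 + h 2) + (f 0 - h 0) +
        (f 1 + h 1))) = _
    rw [show f 2 = -f 0 - f 1 by rw [← sub_eq_zero, ← hs]; abel]
    module
  have o := H.ortho
  have o' : ∀ i j, ⟪h j, f i⟫_ℝ = 0 := fun i j => by rw [real_inner_comm, o]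
  have hd := H.diag
  have c01 := H.cross 0 1 (by decide)
  have c12 := H.cross 1 2 (by decide)
  have c20 := H.cross 2 0 (by decide)
  have key : ∀ i j, i ≠ j → ∀ ε : ℝ, ⟪(1 / 2 : ℝ) • (f i + ε • h i),
      (1 / 2 : ℝ) • (f j - ε • h j)⟫_ℝ = (⟪f i, f j⟫_ℝ - ε ^ 2 * ⟪h i, h j⟫_ℝ) / 4 := by
    intro i j hij ε
    simp only [inner_smul_left, inner_smul_right, inner_add_left, inner_sub_right, o, o',
      conj_trivial]
    ring
  have key₀ : ∀ i, ∀ ε : ℝ, ε ^ 2 = 1 → ⟪(1 / 2 : ℝ) • (f i + ε • h i),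
      (1 / 2 : ℝ) • (f i + ε • h i)⟫_ℝ = 1 := by
    intro i ε hε
    simp only [inner_smul_left, inner_smul_right, inner_add_left, inner_add_right, o, o',
      conj_trivial, hd]
    linear_combination (4 - ⟪f i, f i⟫_ℝ) / 4 * hε
  have kp : ∀ i j, i ≠ j → ⟪(1 / 2 : ℝ) • (f i + h i), (1 / 2 : ℝ) • (f j - h j)⟫_ℝ = -cos θ := by
    intro i j hij
    have := key i j hij 1
    rw [one_smul, one_smul, H.cross i j hij] at this
    rw [this]
    ring
  have km : ∀ i j, i ≠ j → ⟪(1 / 2 : ℝ) • (f i - h i), (1 / 2 : ℝ) • (f j + h j)⟫_ℝ = -cos θ := by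
    intro i j hij
    rw [real_inner_comm]
    exact kp j i hij.symm
  have np : ∀ i, ⟪(1 / 2 : ℝ) • (f i + h i), (1 / 2 : ℝ) • (f i + h i)⟫_ℝ = 1 := by
    intro i
    simpa using key₀ i 1 (by norm_num)
  have nm : ∀ i, ⟪(1 / 2 : ℝ) • (f i - h i), (1 / 2 : ℝ) • (f i - h i)⟫_ℝ = 1 := by
    intro i
    have := key₀ i (-1) (by norm_num)
    rwa [neg_one_smul, ← sub_eq_add_neg] at this
  intro i
  fin_cases i
  · change ⟪edge P 0, edge P 0⟫_ℝ = 1 ∧ ⟪edge P 0, edge P 1⟫_ℝ = _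
    rw [e0, e1]
    exact ⟨np 0, kp 0 1 (by decide)⟩
  · change ⟪edge P 1, edge P 1⟫_ℝ = 1 ∧ ⟪edge P 1, edge P 2⟫_ℝ = _
    rw [e1, e2]
    exact ⟨nm 1, km 1 2 (by decide)⟩
  · change ⟪edge P 2, edge P 2⟫_ℝ = 1 ∧ ⟪edge P 2, edge P 3⟫_ℝ = _
    rw [e2, e3]
    exact ⟨np 2, kp 2 0 (by decide)⟩
  · change ⟪edge P 3, edge P 3⟫_ℝ = 1 ∧ ⟪edge P 3, edge P 4⟫_ℝ = _
    rw [e3, e4]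
    exact ⟨nm 0, km 0 1 (by decide)⟩
  · change ⟪edge P 4, edge P 4⟫_ℝ = 1 ∧ ⟪edge P 4, edge P 5⟫_ℝ = _
    rw [e4, e5]
    exact ⟨np 1, kp 1 2 (by decide)⟩
  · change ⟪edge P 5, edge P 5⟫_ℝ = 1 ∧ ⟪edge P 5, edge P 0⟫_ℝ = _
    rw [e5, e0]
    exact ⟨nm 2, km 2 0 (by decide)⟩

/-! ### Hexagons with even parts on a line -/

/-- The Gram matrix of the odd parts of a hexagon whose even parts are the multiples `φ i • n` of a
unit vector `n`. -/
def oddGram (k : ℝ) (φ : Fin 3 → ℝ) (i j : Fin 3) : ℝ :=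
  if i = j then 4 - φ i ^ 2 else φ i * φ j + 4 - 2 * k

/-- The square root of the sum of all cofactors of `oddGram k φ`, if `φ` sums to zero. -/
noncomputable def oddScale (k : ℝ) (φ : Fin 3 → ℝ) : ℝ :=
  √(2 * k * (6 * k - (φ 0 ^ 2 + φ 1 ^ 2 + φ 2 ^ 2)))

/-- The entry with index `1` of the kernel vector `q = adj(G) 1 / √(1ᵀ adj(G) 1)` of the singular
matrix `G = oddGram k φ`, where `1` is the vector of ones. This normalization is continuous in `φ`,
has `adj(G) = q qᵀ`, and does not change when `φ` is replaced by `-φ`. -/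
noncomputable def oddKernel₁ (k : ℝ) (φ : Fin 3 → ℝ) : ℝ :=
  let G := oddGram k φ
  (G 0 2 * G 1 2 - G 0 1 * G 2 2 + (G 0 0 * G 2 2 - G 0 2 ^ 2) +
    (G 0 1 * G 0 2 - G 0 0 * G 1 2)) / oddScale k φ

/-- The entry with index `2` of the kernel vector described at `oddKernel₁`. -/
noncomputable def oddKernel₂ (k : ℝ) (φ : Fin 3 → ℝ) : ℝ :=
  let G := oddGram k φ
  (G 0 1 * G 1 2 - G 0 2 * G 1 1 + (G 0 1 * G 0 2 - G 0 0 * G 1 2) +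
    (G 0 0 * G 1 1 - G 0 1 ^ 2)) / oddScale k φ

/-- If `oddGram k φ` is singular, these are three vectors with this Gram matrix in the plane with
orthonormal basis `u₁, u₂`. The first one is a positive multiple of `u₁`; the entries of the kernel
vector are the oriented areas spanned by pairs of the vectors. -/
noncomputable def ringOdd (k : ℝ) (φ : Fin 3 → ℝ) (u₁ u₂ : Space3) : Fin 3 → Space3 :=
  ![√(oddGram k φ 0 0) • u₁,
    (oddGram k φ 0 1 / √(oddGram k φ 0 0)) • u₁ + (oddKernel₂ k φ / √(oddGram k φ 0 0)) • u₂,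
    (oddGram k φ 0 2 / √(oddGram k φ 0 0)) • u₁ - (oddKernel₁ k φ / √(oddGram k φ 0 0)) • u₂]

/-- The even parts `φ i • n` belong to the closed curve of hexagons through the boats: they sum to
zero, the Gram matrix of the odd parts is singular, and the point lies on the branch near the
boats. -/
structure IsRingPoint (k : ℝ) (φ : Fin 3 → ℝ) : Prop where
  sum_eq : φ 2 = -φ 0 - φ 1
  prod_sq : (φ 0 * φ 1 * φ 2) ^ 2 =
    2 * k * (φ 0 ^ 2 + φ 1 ^ 2 + φ 2 ^ 2) - 4 * k ^ 2 * (3 - k)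
  sum_sq_lt : φ 0 ^ 2 + φ 1 ^ 2 + φ 2 ^ 2 < 6

theorem oddGram_diag (k : ℝ) (φ : Fin 3 → ℝ) (i : Fin 3) : oddGram k φ i i = 4 - φ i ^ 2 :=
  if_pos rfl

theorem oddGram_of_ne (k : ℝ) (φ : Fin 3 → ℝ) {i j : Fin 3} (h : i ≠ j) :
    oddGram k φ i j = φ i * φ j + 4 - 2 * k :=
  if_neg h

namespace IsRingPoint

variable {k : ℝ} {φ : Fin 3 → ℝ}

theorem oddGram_pos (H : IsRingPoint k φ) : 0 < oddGram k φ 0 0 := by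
  have h := H.sum_sq_lt
  rw [oddGram_diag]
  rw [H.sum_eq] at h
  nlinarith [sq_nonneg (φ 0 + 2 * φ 1)]

theorem oddScale_sq (H : IsRingPoint k φ) (hk : 1 < k) :
    oddScale k φ ^ 2 = 2 * k * (6 * k - (φ 0 ^ 2 + φ 1 ^ 2 + φ 2 ^ 2)) ∧ 0 < oddScale k φ := by
  have h : 0 < 2 * k * (6 * k - (φ 0 ^ 2 + φ 1 ^ 2 + φ 2 ^ 2)) :=
    mul_pos (by linarith) (by linarith [H.sum_sq_lt])
  exact ⟨Real.sq_sqrt h.le, Real.sqrt_pos.2 h⟩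

theorem oddGram_det (H : IsRingPoint k φ) :
    let G := oddGram k φ
    G 0 0 * G 1 1 * G 2 2 + 2 * G 0 1 * G 1 2 * G 0 2 - G 0 0 * G 1 2 ^ 2 - G 1 1 * G 0 2 ^ 2
      - G 2 2 * G 0 1 ^ 2 = 0 := by
  have h := H.prod_sq
  simp only [oddGram_diag, oddGram_of_ne k φ (show (0 : Fin 3) ≠ 1 by decide),
    oddGram_of_ne k φ (show (1 : Fin 3) ≠ 2 by decide),
    oddGram_of_ne k φ (show (0 : Fin 3) ≠ 2 by decide)]
  rw [H.sum_eq] at h ⊢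
  linear_combination 4 * h

/-- The relevant entries of `adj(G) = q qᵀ`, by Jacobi's identity for the minors of `adj(G)`. -/
theorem kernel_mul (H : IsRingPoint k φ) (hk : 1 < k) :
    oddKernel₂ k φ ^ 2 = oddGram k φ 0 0 * oddGram k φ 1 1 - oddGram k φ 0 1 ^ 2 ∧
    oddKernel₁ k φ ^ 2 = oddGram k φ 0 0 * oddGram k φ 2 2 - oddGram k φ 0 2 ^ 2 ∧
    oddKernel₁ k φ * oddKernel₂ k φ =
      oddGram k φ 0 1 * oddGram k φ 0 2 - oddGram k φ 0 0 * oddGram k φ 1 2 := by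
  obtain ⟨hs, hpos⟩ := H.oddScale_sq hk
  have hdet := H.oddGram_det
  have hS : oddScale k φ ^ 2 =
      (oddGram k φ 1 1 * oddGram k φ 2 2 - oddGram k φ 1 2 ^ 2) +
      (oddGram k φ 0 0 * oddGram k φ 2 2 - oddGram k φ 0 2 ^ 2) +
      (oddGram k φ 0 0 * oddGram k φ 1 1 - oddGram k φ 0 1 ^ 2) +
      2 * (oddGram k φ 0 2 * oddGram k φ 1 2 - oddGram k φ 0 1 * oddGram k φ 2 2) +
      2 * (oddGram k φ 0 1 * oddGram k φ 0 2 - oddGram k φ 0 0 * oddGram k φ 1 2) +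
      2 * (oddGram k φ 0 1 * oddGram k φ 1 2 - oddGram k φ 0 2 * oddGram k φ 1 1) := by
    rw [hs]
    simp only [oddGram_diag, oddGram_of_ne k φ (show (0 : Fin 3) ≠ 1 by decide),
      oddGram_of_ne k φ (show (1 : Fin 3) ≠ 2 by decide),
      oddGram_of_ne k φ (show (0 : Fin 3) ≠ 2 by decide), H.sum_eq]
    ring
  have hne : oddScale k φ ≠ 0 := hpos.ne'
  simp only [oddKernel₁, oddKernel₂] at hdet ⊢
  generalize oddGram k φ 0 0 = a at *
  generalize oddGram k φ 1 1 = b at *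
  generalize oddGram k φ 2 2 = c at *
  generalize oddGram k φ 0 1 = d at *
  generalize oddGram k φ 1 2 = e at *
  generalize oddGram k φ 0 2 = g at *
  refine ⟨?_, ?_, ?_⟩
  · rw [div_pow, div_eq_iff (pow_ne_zero 2 hne), hS]
    linear_combination -(a + b - 2 * d) * hdet
  · rw [div_pow, div_eq_iff (pow_ne_zero 2 hne), hS]
    linear_combination -(a + c - 2 * g) * hdet
  · rw [div_mul_div_comm, ← sq, div_eq_iff (pow_ne_zero 2 hne), hS]
    linear_combination (e + a - d - g) * hdet

theorem isSplitHexagon (H : IsRingPoint k φ) (hk : 1 < k) {u₁ u₂ n : Space3}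
    (h₁ : ⟪u₁, u₁⟫_ℝ = 1) (h₂ : ⟪u₂, u₂⟫_ℝ = 1) (h₃ : ⟪n, n⟫_ℝ = 1) (h₁₂ : ⟪u₁, u₂⟫_ℝ = 0)
    (h₁₃ : ⟪n, u₁⟫_ℝ = 0) (h₂₃ : ⟪n, u₂⟫_ℝ = 0) :
    IsSplitHexagon k (fun i => φ i • n) (ringOdd k φ u₁ u₂) := by
  have h₂₁ : ⟪u₂, u₁⟫_ℝ = 0 := by rw [real_inner_comm, h₁₂]
  have hG := H.oddGram_pos
  obtain ⟨k2, k1, k12⟩ := H.kernel_mul hk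
  have ha : √(oddGram k φ 0 0) ^ 2 = oddGram k φ 0 0 := Real.sq_sqrt hG.le
  have ha0 : √(oddGram k φ 0 0) ≠ 0 := (Real.sqrt_pos.2 hG).ne'
  have key : ∀ i j, ⟪ringOdd k φ u₁ u₂ i, ringOdd k φ u₁ u₂ j⟫_ℝ = oddGram k φ i j := by
    have hsymm : ∀ i j, oddGram k φ i j = oddGram k φ j i := by
      intro i j
      by_cases h : i = j
      · rw [h]
      · rw [oddGram_of_ne k φ h, oddGram_of_ne k φ (Ne.symm h)]
        ring
    rw [← ha] at k2 k1 k12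
    have k00 : ⟪ringOdd k φ u₁ u₂ 0, ringOdd k φ u₁ u₂ 0⟫_ℝ = oddGram k φ 0 0 := by
      simp only [ringOdd, Matrix.cons_val, inner_smul_left, inner_smul_right, h₁, conj_trivial]
      linear_combination ha
    have k01 : ⟪ringOdd k φ u₁ u₂ 0, ringOdd k φ u₁ u₂ 1⟫_ℝ = oddGram k φ 0 1 := by
      simp only [ringOdd, Matrix.cons_val, inner_add_right, inner_smul_left, inner_smul_right,
        h₁, h₁₂, conj_trivial]
      field_simp
      ring
    have k02 : ⟪ringOdd k φ u₁ u₂ 0, ringOdd k φ u₁ u₂ 2⟫_ℝ = oddGram k φ 0 2 := by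
      simp only [ringOdd, Matrix.cons_val, inner_sub_right, inner_smul_left, inner_smul_right,
        h₁, h₁₂, conj_trivial]
      field_simp
      ring
    have k11 : ⟪ringOdd k φ u₁ u₂ 1, ringOdd k φ u₁ u₂ 1⟫_ℝ = oddGram k φ 1 1 := by
      simp only [ringOdd, Matrix.cons_val, inner_add_left, inner_add_right, inner_smul_left,
        inner_smul_right, h₁, h₂, h₁₂, h₂₁, conj_trivial]
      field_simp
      linear_combination k2
    have k22 : ⟪ringOdd k φ u₁ u₂ 2, ringOdd k φ u₁ u₂ 2⟫_ℝ = oddGram k φ 2 2 := by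
      simp only [ringOdd, Matrix.cons_val, inner_sub_left, inner_sub_right, inner_smul_left,
        inner_smul_right, h₁, h₂, h₁₂, h₂₁, conj_trivial]
      field_simp
      linear_combination k1
    have k12' : ⟪ringOdd k φ u₁ u₂ 1, ringOdd k φ u₁ u₂ 2⟫_ℝ = oddGram k φ 1 2 := by
      simp only [ringOdd, Matrix.cons_val, inner_add_left, inner_sub_right, inner_smul_left,
        inner_smul_right, h₁, h₂, h₁₂, h₂₁, conj_trivial]
      field_simp
      linear_combination -k12
    intro i j
    fin_cases i <;> fin_cases j
    · exact k00
    · exact k01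
    · exact k02
    · exact (real_inner_comm _ _).trans (k01.trans (hsymm _ _))
    · exact k11
    · exact k12'
    · exact (real_inner_comm _ _).trans (k02.trans (hsymm _ _))
    · exact (real_inner_comm _ _).trans (k12'.trans (hsymm _ _))
    · exact k22
  refine ⟨?_, ?_, ?_, ?_⟩
  · rw [H.sum_eq]
    module
  · intro i j
    fin_cases j <;>
      simp [ringOdd, inner_smul_left, inner_smul_right, inner_add_right, inner_sub_right, h₁₃, h₂₃]
  · intro i
    rw [key, oddGram_diag, inner_smul_left, inner_smul_right, h₃, conj_trivial]
    ring
  · intro i j hij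
    rw [key, oddGram_of_ne k φ hij, inner_smul_left, inner_smul_right, h₃, conj_trivial]
    ring

end IsRingPoint

/-! ### The path from a boat to its mirror image -/

/-- For `1 < k < 3` the fixed point of the contraction `z ↦ (c z³ + k²(3 - k)) / (3k)` of `[0, 1]`
depends continuously on the parameter `c ∈ [0, 1]`. -/
theorem exists_continuous_root {k : ℝ} (hk₁ : 1 < k) (hk₃ : k < 3) :
    ∃ Z : ℝ → ℝ, ContinuousOn Z (Set.Icc 0 1) ∧ ∀ c ∈ Set.Icc (0 : ℝ) 1,
      0 < Z c ∧ Z c < 1 ∧ c * Z c ^ 3 - 3 * k * Z c + k ^ 2 * (3 - k) = 0 := by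
  have hroot : ∀ c : ℝ, ∃ z, c ∈ Set.Icc (0 : ℝ) 1 →
      0 < z ∧ z < 1 ∧ c * z ^ 3 - 3 * k * z + k ^ 2 * (3 - k) = 0 := by
    intro c
    by_cases hc : c ∈ Set.Icc (0 : ℝ) 1
    · have hcont : ContinuousOn (fun z : ℝ => c * z ^ 3 - 3 * k * z + k ^ 2 * (3 - k))
          (Set.Icc 0 1) := by fun_prop
      have h0 : 0 < c * (0 : ℝ) ^ 3 - 3 * k * 0 + k ^ 2 * (3 - k) := by
        have : 0 < k ^ 2 * (3 - k) := mul_pos (by positivity) (by linarith)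
        linarith
      -- at `z = 1` the value is at most `(1 - k)³`
      have h1 : c * (1 : ℝ) ^ 3 - 3 * k * 1 + k ^ 2 * (3 - k) < 0 := by
        have : 0 < (k - 1) ^ 3 := pow_pos (by linarith) 3
        nlinarith [hc.2]
      obtain ⟨z, hz, hz0⟩ := intermediate_value_Icc' zero_le_one hcont ⟨h1.le, h0.le⟩
      refine ⟨z, fun _ => ⟨lt_of_le_of_ne hz.1 ?_, lt_of_le_of_ne hz.2 ?_, hz0⟩⟩
      · rintro rfl
        exact h0.ne' hz0
      · rintro rfl
        exact h1.ne hz0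
    · exact ⟨0, fun h => absurd h hc⟩
  choose Z hZ using hroot
  refine ⟨Z, ?_, hZ⟩
  have hlip : LipschitzOnWith (Real.toNNReal (1 / (3 * (k - 1)))) Z (Set.Icc 0 1) := by
    refine LipschitzOnWith.of_dist_le_mul fun c hc d hd => ?_
    obtain ⟨hx0, hx1, hx⟩ := hZ c hc
    obtain ⟨hy0, hy1, hy⟩ := hZ d hd
    have hk : 0 < 3 * (k - 1) := by linarith
    rw [Real.coe_toNNReal _ (by positivity), Real.dist_eq, Real.dist_eq, div_mul_eq_mul_div,
      one_mul, le_div_iff₀ hk]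
    generalize Z c = x at *
    generalize Z d = y at *
    have e : 3 * k * (x - y) = (c - d) * x ^ 3 + d * (x ^ 2 + x * y + y ^ 2) * (x - y) := by
      linear_combination hy - hx
    have hd3 : |d * (x ^ 2 + x * y + y ^ 2)| ≤ 3 := by
      have : x ^ 2 + x * y + y ^ 2 ≤ 3 := by nlinarith
      have h0 : 0 ≤ x ^ 2 + x * y + y ^ 2 := by positivity
      rw [abs_of_nonneg (mul_nonneg hd.1 h0)]
      nlinarith [hd.2, hd.1]
    have hx3 : |x ^ 3| ≤ 1 := by
      rw [abs_of_nonneg (by positivity)]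
      exact pow_le_one₀ hx0.le hx1.le
    have h₁ : |3 * k * (x - y)| ≤ |c - d| * 1 + 3 * |x - y| := by
      rw [e]
      refine (abs_add_le _ _).trans (add_le_add ?_ ?_)
      · rw [abs_mul]
        exact mul_le_mul_of_nonneg_left hx3 (abs_nonneg _)
      · rw [abs_mul]
        exact mul_le_mul_of_nonneg_right hd3 (abs_nonneg _)
    rw [abs_mul, abs_of_pos (by linarith : 0 < 3 * k)] at h₁
    linarith
  exact hlip.continuousOn

/-- The coefficients `2 √z cos (α + 2πi/3)` of the even parts. -/
noncomputable def ringEven (z α : ℝ) : Fin 3 → ℝ :=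
  ![2 * √z * cos α, 2 * √z * (-(1 / 2) * cos α - √3 / 2 * sin α),
    2 * √z * (-(1 / 2) * cos α + √3 / 2 * sin α)]

theorem isRingPoint_ringEven {k z α : ℝ} (hz₀ : 0 < z) (hz₁ : z < 1)
    (hz : cos (3 * α) ^ 2 * z ^ 3 - 3 * k * z + k ^ 2 * (3 - k) = 0) :
    IsRingPoint k (ringEven z α) := by
  have h3 : √3 ^ 2 = (3 : ℝ) := Real.sq_sqrt (by norm_num)
  have hzz : √z ^ 2 = z := Real.sq_sqrt hz₀.le
  have hcs := sin_sq_add_cos_sq α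
  have hρ : ringEven z α 0 ^ 2 + ringEven z α 1 ^ 2 + ringEven z α 2 ^ 2 = 6 * z := by
    simp only [ringEven, Matrix.cons_val]
    linear_combination 2 * √z ^ 2 * sin α ^ 2 * h3 + 6 * √z ^ 2 * hcs + 6 * hzz
  have hπ : ringEven z α 0 * ringEven z α 1 * ringEven z α 2 =
      2 * √z ^ 3 * cos (3 * α) := by
    rw [cos_three_mul]
    simp only [ringEven, Matrix.cons_val]
    linear_combination -2 * √z ^ 3 * cos α * sin α ^ 2 * h3 - 6 * √z ^ 3 * cos α * hcs
  refine ⟨?_, ?_, ?_⟩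
  · simp only [ringEven, Matrix.cons_val]
    ring
  · rw [hρ, hπ]
    have : √z ^ 6 = z ^ 3 := by rw [← hzz]; ring_nf; rw [hzz]
    linear_combination 4 * cos (3 * α) ^ 2 * this + 4 * hz
  · rw [hρ]
    linarith

theorem ringEven_add_pi (z α : ℝ) (i : Fin 3) : ringEven z (α + π) i = -ringEven z α i := by
  fin_cases i <;> simp [ringEven] <;> ring

theorem ringOdd_neg (k : ℝ) (φ : Fin 3 → ℝ) (u₁ u₂ : Space3) :
    ringOdd k (fun i => -φ i) u₁ u₂ = ringOdd k φ u₁ u₂ := by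
  have hG : oddGram k (fun i => -φ i) = oddGram k φ := by
    funext i j
    simp [oddGram]
  have hS : oddScale k (fun i => -φ i) = oddScale k φ := by simp [oddScale]
  simp only [ringOdd, oddKernel₁, oddKernel₂, hG, hS]

theorem continuous_ringOdd {X : Type*} [TopologicalSpace X] {k : ℝ} (hk : 1 < k)
    {φ : X → Fin 3 → ℝ} (hφ : Continuous φ) (H : ∀ x, IsRingPoint k (φ x)) (u₁ u₂ : Space3)
    (i : Fin 3) : Continuous fun x => ringOdd k (φ x) u₁ u₂ i := by
  have hφi : ∀ i, Continuous fun x => φ x i := fun i => (continuous_apply i).comp hφ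
  have hG : ∀ i j, Continuous fun x => oddGram k (φ x) i j := by
    intro i j
    by_cases h : i = j
    · subst h
      simp only [oddGram_diag]
      fun_prop
    · simp only [oddGram_of_ne k _ h]
      fun_prop
  have hS : Continuous fun x => oddScale k (φ x) := by
    unfold oddScale
    fun_prop
  have hS0 : ∀ x, oddScale k (φ x) ≠ 0 := fun x => ((H x).oddScale_sq hk).2.ne'
  have ha : Continuous fun x => √(oddGram k (φ x) 0 0) := (hG 0 0).sqrt
  have ha0 : ∀ x, √(oddGram k (φ x) 0 0) ≠ 0 := fun x => (Real.sqrt_pos.2 (H x).oddGram_pos).ne'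
  have hk1 : Continuous fun x => oddKernel₁ k (φ x) := by
    unfold oddKernel₁
    exact Continuous.div (by fun_prop) hS hS0
  have hk2 : Continuous fun x => oddKernel₂ k (φ x) := by
    unfold oddKernel₂
    exact Continuous.div (by fun_prop) hS hS0
  fin_cases i
  · exact ha.smul continuous_const
  · exact (((hG 0 1).div ha ha0).smul continuous_const).add
      ((hk2.div ha ha0).smul continuous_const)
  · exact (((hG 0 2).div ha ha0).smul continuous_const).sub
      ((hk1.div ha ha0).smul continuous_const)

theorem continuous_hexagonOfParts {X : Type*} [TopologicalSpace X] (A : Space3)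
    {f h : X → Fin 3 → Space3} (hf : ∀ i, Continuous fun x => f x i)
    (hh : ∀ i, Continuous fun x => h x i) :
    Continuous fun x => hexagonOfParts A (f x) (h x) := by
  refine continuous_pi fun i => ?_
  fin_cases i <;> simp [hexagonOfParts] <;> fun_prop

/-- In a suitable orthonormal frame a boat has the parts `φ i • n` and `ringOdd k φ u₁ u₂`. The
vector `u₂` is chosen such that the second odd part is correct; the third one is then forced, as it
is a linear combination of the first two. -/
theorem IsSplitHexagon.exists_frame {k : ℝ} {f h : Fin 3 → Space3} (H : IsSplitHexagon k f h)
    (hk₁ : 1 < k) (hk₃ : k < 3) (h1 : f 1 = 0) (h0 : f 0 ≠ 0) {φ : Fin 3 → ℝ}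
    (hφ : IsRingPoint k φ) (hφ₀ : φ 0 = √(k * (3 - k))) (hφ₁ : φ 1 = 0) :
    ∃ u₁ u₂ n : Space3, ⟪u₁, u₁⟫_ℝ = 1 ∧ ⟪u₂, u₂⟫_ℝ = 1 ∧ ⟪n, n⟫_ℝ = 1 ∧ ⟪u₁, u₂⟫_ℝ = 0 ∧
      ⟪n, u₁⟫_ℝ = 0 ∧ ⟪n, u₂⟫_ℝ = 0 ∧ f = (fun i => φ i • n) ∧ h = ringOdd k φ u₁ u₂ := by
  have hpos : 0 < k * (3 - k) := mul_pos (by linarith) (by linarith)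
  have hφ₂ : φ 2 = -φ 0 := by rw [hφ.sum_eq, hφ₁, sub_zero]
  have hφ0 : φ 0 ^ 2 = k * (3 - k) := by rw [hφ₀, Real.sq_sqrt hpos.le]
  have hφ0' : φ 0 ≠ 0 := by rw [hφ₀]; exact (Real.sqrt_pos.2 hpos).ne'
  have hf00 := (H.even_sq_eq (by linarith) h1 h0).2
  have hf2 : f 2 = -f 0 := by
    have := H.sum_eq_zero
    rw [h1, add_zero] at this
    exact (neg_eq_of_add_eq_zero_right this).symm
  have hG00 : oddGram k φ 0 0 = 4 - k * (3 - k) := by rw [oddGram_diag, hφ0]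
  have hG11 : oddGram k φ 1 1 = 4 := by rw [oddGram_diag, hφ₁]; ring
  have hG22 : oddGram k φ 2 2 = 4 - k * (3 - k) := by rw [oddGram_diag, hφ₂, neg_sq, hφ0]
  have hG01 : oddGram k φ 0 1 = 4 - 2 * k := by
    rw [oddGram_of_ne k φ (by decide), hφ₁]; ring
  have hG12 : oddGram k φ 1 2 = 4 - 2 * k := by
    rw [oddGram_of_ne k φ (by decide), hφ₁]; ring
  have hG02 : oddGram k φ 0 2 = 4 - 2 * k - k * (3 - k) := by
    rw [oddGram_of_ne k φ (by decide), hφ₂]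
    linear_combination -hφ0
  have hGpos := hφ.oddGram_pos
  obtain ⟨hS, hS0⟩ := hφ.oddScale_sq hk₁
  have hK2 : oddKernel₂ k φ = 4 * k ^ 2 / oddScale k φ := by
    simp only [oddKernel₂, hG00, hG11, hG01, hG12, hG02]
    congr 1
    ring
  have hK1 : oddKernel₁ k φ = -(2 - k) * oddKernel₂ k φ := by
    rw [hK2, ← mul_div_assoc]
    simp only [oddKernel₁, hG00, hG22, hG01, hG12, hG02]
    congr 1
    ring
  have hK2sq := (hφ.kernel_mul hk₁).1
  rw [hG11, hG01] at hK2sq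
  have hK20 : oddKernel₂ k φ ≠ 0 := by
    rw [hK2]
    positivity
  have ha2 : √(oddGram k φ 0 0) ^ 2 = oddGram k φ 0 0 := Real.sq_sqrt hGpos.le
  have ha0 : √(oddGram k φ 0 0) ≠ 0 := (Real.sqrt_pos.2 hGpos).ne'
  have i00 : ⟪h 0, h 0⟫_ℝ = oddGram k φ 0 0 := by rw [H.diag, hf00, hG00]
  have i11 : ⟪h 1, h 1⟫_ℝ = 4 := by rw [H.diag, h1, inner_zero_left, sub_zero]
  have i22 : ⟪h 2, h 2⟫_ℝ = oddGram k φ 0 0 := by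
    rw [H.diag, hf2, inner_neg_neg, hf00, hG00]
  have i01 : ⟪h 0, h 1⟫_ℝ = 4 - 2 * k := by
    rw [H.cross 0 1 (by decide), h1, inner_zero_right]; ring
  have i10 : ⟪h 1, h 0⟫_ℝ = 4 - 2 * k := by rw [real_inner_comm, i01]
  have i12 : ⟪h 1, h 2⟫_ℝ = 4 - 2 * k := by
    rw [H.cross 1 2 (by decide), h1, inner_zero_left]; ring
  have i21 : ⟪h 2, h 1⟫_ℝ = 4 - 2 * k := by rw [real_inner_comm, i12]
  have i02 : ⟪h 0, h 2⟫_ℝ = 4 - 2 * k - k * (3 - k) := by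
    rw [H.cross 0 2 (by decide), hf2, inner_neg_right, hf00]; ring
  have i20 : ⟪h 2, h 0⟫_ℝ = 4 - 2 * k - k * (3 - k) := by rw [real_inner_comm, i02]
  -- the odd parts of a boat are linearly dependent
  have hh2 : h 2 = (2 - k) • h 1 - h 0 := by
    rw [← sub_eq_zero, ← inner_self_eq_zero (𝕜 := ℝ)]
    simp only [inner_sub_left, inner_sub_right, inner_smul_left, inner_smul_right, conj_trivial,
      i00, i01, i10, i11, i12, i21, i02, i20, i22, hG00]
    ring
  set a := √(oddGram k φ 0 0) with ha
  set q := oddKernel₂ k φ with hq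
  refine ⟨a⁻¹ • h 0, (a / q) • (h 1 - ((4 - 2 * k) / a ^ 2) • h 0), (φ 0)⁻¹ • f 0,
    ?_, ?_, ?_, ?_, ?_, ?_, ?_, ?_⟩
  · rw [inner_smul_left, inner_smul_right, i00, conj_trivial, ← ha2]
    field_simp
  · simp only [inner_sub_left, inner_sub_right, inner_smul_left, inner_smul_right, conj_trivial,
      i00, i01, i10, i11, ← ha2]
    rw [← ha2] at hK2sq
    field_simp
    linear_combination -hK2sq
  · rw [inner_smul_left, inner_smul_right, hf00, conj_trivial, ← hφ0]
    field_simp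
  · simp only [inner_sub_right, inner_smul_left, inner_smul_right, conj_trivial,
      i00, i01, ← ha2]
    field_simp
    ring
  · rw [inner_smul_left, inner_smul_right, H.ortho]
    ring
  · simp only [inner_smul_left, inner_smul_right, inner_sub_right, H.ortho]
    ring
  · funext i
    fin_cases i
    · change f 0 = φ 0 • _
      rw [smul_smul, mul_inv_cancel₀ hφ0', one_smul]
    · change f 1 = φ 1 • _
      rw [h1, hφ₁, zero_smul]
    · change f 2 = φ 2 • _
      rw [smul_smul, hφ₂, neg_mul, mul_inv_cancel₀ hφ0', hf2, neg_one_smul]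
  · have e1 : h 1 = (oddGram k φ 0 1 / a) • a⁻¹ • h 0 +
        (q / a) • (a / q) • (h 1 - ((4 - 2 * k) / a ^ 2) • h 0) := by
      rw [hG01, smul_smul, smul_smul, show q / a * (a / q) = 1 by field_simp,
        show (4 - 2 * k) / a * a⁻¹ = (4 - 2 * k) / a ^ 2 by field_simp]
      module
    funext i
    fin_cases i
    · change h 0 = a • a⁻¹ • h 0
      rw [smul_smul, mul_inv_cancel₀ ha0, one_smul]
    · exact e1
    · change h 2 = (oddGram k φ 0 2 / a) • a⁻¹ • h 0 -
        (oddKernel₁ k φ / a) • (a / q) • (h 1 - ((4 - 2 * k) / a ^ 2) • h 0)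
      rw [hh2, hK1, hG02, smul_smul, smul_smul,
        show -(2 - k) * q / a * (a / q) = -(2 - k) by field_simp,
        show (4 - 2 * k - k * (3 - k)) / a * a⁻¹ = (2 - k) * ((4 - 2 * k) / a ^ 2) - 1 by
          rw [eq_sub_iff_add_eq]
          field_simp
          rw [ha2, hG00]
          ring]
      module

/-- Changing the sign of the even parts reflects the hexagon in a plane, which yields a hexagon
congruent to its mirror image. -/
theorem exists_congruence_mirror (A n : Space3) (hn : n ≠ 0) {f h : Fin 3 → Space3} (φ : Fin 3 → ℝ)
    (hf : ∀ i, f i = φ i • n) (hh : ∀ i, ⟪n, h i⟫_ℝ = 0) :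
    ∃ g ∈ orientationPreservingIsometries, ∀ j,
      g (hexagonOfParts A (fun i => -f i) h j) = horizontalReflection (hexagonOfParts A f h j) := by
  set ρ := (Submodule.span ℝ {n})ᗮ.reflection with hρ
  have hdet : LinearMap.det (ρ.toLinearEquiv : Space3 →ₗ[ℝ] Space3) = -1 := by
    have h := (Submodule.span ℝ {n})ᗮ.det_reflection
    rw [Submodule.orthogonal_orthogonal, finrank_span_singleton hn, pow_one] at h
    exact h
  have hρn : ρ n = -n := Submodule.reflection_orthogonalComplement_singleton_eq_neg n
  have hρf : ∀ i, ρ (-f i) = f i := fun i => by rw [hf, map_neg, map_smul, hρn, smul_neg, neg_neg]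
  have hρh : ∀ i, ρ (h i) = h i := fun i =>
    Submodule.reflection_mem_subspace_eq_self (Submodule.mem_orthogonal_singleton_iff_inner_right.2
      (hh i))
  -- the composition of two reflections preserves the orientation
  set L : Space3 ≃ₗᵢ[ℝ] Space3 := ρ.trans horizontalReflection with hL
  have hLdet : 0 < LinearMap.det (L.toLinearEquiv : Space3 →ₗ[ℝ] Space3) := by
    have e : (L.toLinearEquiv : Space3 →ₗ[ℝ] Space3) =
        (horizontalReflection.toLinearEquiv : Space3 →ₗ[ℝ] Space3) ∘ₗ
          (ρ.toLinearEquiv : Space3 →ₗ[ℝ] Space3) := rfl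
    rw [e, LinearMap.det_comp, hdet, det_horizontalReflection]
    norm_num
  have hP : ∀ j, ρ (hexagonOfParts A (fun i => -f i) h j - A) + A = hexagonOfParts A f h j := by
    intro j
    fin_cases j <;> simp only [hexagonOfParts, Fin.zero_eta, Fin.mk_one, Fin.reduceFinMk,
      Matrix.cons_val, sub_self, add_sub_cancel_left, map_smul, map_add, map_sub, map_zero, hρf,
      hρh] <;> module
  refine ⟨AffineIsometryEquiv.mk' (fun x => L (x - A) + horizontalReflection A) L A ?_, ?_, ?_⟩
  · intro x
    simp
  · exact hLdet
  · intro j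
    rw [AffineIsometryEquiv.coe_mk', ← hP j, map_add]
    rfl

/-- The half turn of the parameter `α` from `-π/6`, where the hexagon is the given boat, to `5π/6`.
-/
theorem exists_joined_mirror {θ : ℝ} (hθ₀ : 0 ≤ θ) (hθπ : θ ≤ π) (hk₁ : 1 < 2 - 2 * cos θ)
    (hk₃ : 2 - 2 * cos θ < 3) (P : EquiangularPolygon 6 θ) (h1 : evenPart P.1 1 = 0)
    (h0 : evenPart P.1 0 ≠ 0) :
    ∃ X : EquiangularPolygon 6 θ, Joined P X ∧
      ∃ g ∈ orientationPreservingIsometries, ∀ j, g (X.1 j) = P.mirror.1 j := by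
  have H := P.isSplitHexagon hθ₀ hθπ
  set k := 2 - 2 * cos θ with hk
  obtain ⟨Z, hZc, hZ⟩ := exists_continuous_root hk₁ hk₃
  have hC : ∀ α : ℝ, cos (3 * α) ^ 2 ∈ Set.Icc (0 : ℝ) 1 := fun α =>
    ⟨sq_nonneg _, cos_sq_le_one _⟩
  set φ : ℝ → Fin 3 → ℝ := fun α => ringEven (Z (cos (3 * α) ^ 2)) α with hφdef
  have hφ : ∀ α, IsRingPoint k (φ α) := fun α => by
    obtain ⟨hz₀, hz₁, hz⟩ := hZ _ (hC α)
    exact isRingPoint_ringEven hz₀ hz₁ hz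
  have hφc : Continuous φ := by
    have hz : Continuous fun α : ℝ => Z (cos (3 * α) ^ 2) :=
      hZc.comp_continuous (by fun_prop) hC
    refine continuous_pi fun i => ?_
    fin_cases i <;> exact (continuous_const.mul hz.sqrt).mul (by fun_prop)
  have hφπ : φ (-(π / 6) + π) = fun i => -φ (-(π / 6)) i := by
    funext i
    have : cos (3 * (-(π / 6) + π)) ^ 2 = cos (3 * (-(π / 6))) ^ 2 := by
      rw [show 3 * (-(π / 6) + π) = 3 * (-(π / 6)) + π + 2 * π by ring, cos_add_two_pi, cos_add_pi,
        neg_sq]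
    simp only [hφdef, this, ringEven_add_pi]
  have hcos : cos (3 * (-(π / 6))) = 0 := by
    rw [show 3 * (-(π / 6)) = -(π / 2) by ring, cos_neg, cos_pi_div_two]
  have h3 : √3 ^ 2 = (3 : ℝ) := Real.sq_sqrt (by norm_num)
  have hφ₀ : φ (-(π / 6)) 0 = √(k * (3 - k)) := by
    obtain ⟨hz₀, -, hz⟩ := hZ _ (hC (-(π / 6)))
    simp only [hφdef, ringEven, Matrix.cons_val, cos_neg, cos_pi_div_six]
    have hz3 : k * (3 - k) = 3 * Z (cos (3 * (-(π / 6))) ^ 2) := by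
      rw [hcos] at hz ⊢
      have hk0 : k ≠ 0 := by linarith
      exact mul_left_cancel₀ hk0 (by linear_combination hz)
    rw [hz3, Real.sqrt_mul (by norm_num)]
    ring
  have hφ₁ : φ (-(π / 6)) 1 = 0 := by
    simp only [hφdef, ringEven, Matrix.cons_val, cos_neg, cos_pi_div_six, sin_neg, sin_pi_div_six]
    ring
  obtain ⟨u₁, u₂, n, a₁, a₂, a₃, a₁₂, a₁₃, a₂₃, hf, hh⟩ :=
    H.exists_frame hk₁ hk₃ h1 h0 (hφ _) hφ₀ hφ₁
  have hR : ∀ α, IsSplitHexagon k (fun i => φ α i • n) (ringOdd k (φ α) u₁ u₂) := fun α =>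
    (hφ α).isSplitHexagon hk₁ a₁ a₂ a₃ a₁₂ a₁₃ a₂₃
  set γ : ℝ → EquiangularPolygon 6 θ := fun α =>
    ⟨hexagonOfParts (P.1 0) (fun i => φ α i • n) (ringOdd k (φ α) u₁ u₂),
      isEquiangularUnitPolygon_hexagonOfParts hθ₀ hθπ (hR α) _⟩ with hγ
  have hγc : Continuous γ := by
    refine Continuous.subtype_mk (continuous_hexagonOfParts _ (fun i => ?_) fun i =>
      continuous_ringOdd hk₁ hφc hφ u₁ u₂ i) _
    exact ((continuous_apply i).comp hφc).smul continuous_const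
  have hγ₀ : γ (-(π / 6)) = P := by
    refine Subtype.ext ?_
    simp only [hγ]
    rw [← hf, ← hh, hexagonOfParts_evenPart_oddPart]
  refine ⟨γ (-(π / 6) + π), ?_, ?_⟩
  · have := (PathConnectedSpace.joined (-(π / 6)) (-(π / 6) + π)).map hγc
    rwa [hγ₀] at this
  · have hn : n ≠ 0 := by
      rintro rfl
      simp at a₃
    have hnh : ∀ i, ⟪n, oddPart P.1 i⟫_ℝ = 0 := fun i => by
      have h := H.ortho 0 i
      rw [hf, inner_smul_left, conj_trivial] at h
      refine (mul_eq_zero.1 h).resolve_left fun hc => h0 ?_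
      rw [hf]
      exact (congrArg (· • n) hc).trans (zero_smul ℝ n)
    obtain ⟨g, hg, hgj⟩ := exists_congruence_mirror (P.1 0) n hn (φ (-(π / 6)))
      (fun i => congrFun hf i) hnh
    refine ⟨g, hg, fun j => ?_⟩
    have := hgj j
    rw [hexagonOfParts_evenPart_oddPart] at this
    rw [show P.mirror.1 j = horizontalReflection (P.1 j) from rfl, ← this]
    congr 1
    simp only [hγ]
    rw [hφπ, ringOdd_neg, ← hh]
    simp only [neg_smul]
    rw [hf]

theorem joined_boat_mirror {θ : ℝ} (hθ₀ : 0 ≤ θ) (hθπ : θ ≤ π) (hk₁ : 1 < 2 - 2 * cos θ)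
    {B : EquiangularPolygon 6 θ} (hB : B.IsBoat) : Joined B.toConfig B.mirror.toConfig := by
  obtain ⟨i, h1, h0⟩ := hB.exists_relabel
  obtain ⟨X, hX, g, hg, hgX⟩ := exists_joined_mirror hθ₀ hθπ hk₁ (hB.param_mem hθ₀ hθπ).2 _ h1 h0
  have hc : Continuous fun P : EquiangularPolygon 6 θ => (P.relabel (-i)).toConfig := by
    refine continuous_quotient_mk'.comp (Continuous.subtype_mk ?_ _)
    exact continuous_pi fun j => (continuous_apply _).comp continuous_subtype_val
  have h := hX.map hc
  have e₁ : (B.relabel i).relabel (-i) = B := by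
    refine Subtype.ext (funext fun j => ?_)
    simp [EquiangularPolygon.relabel]
  have e₂ : (X.relabel (-i)).toConfig = B.mirror.toConfig := by
    refine Quotient.sound ⟨g, hg, fun j => ?_⟩
    refine (hgX (j + -i)).trans ?_
    simp [EquiangularPolygon.relabel, EquiangularPolygon.mirror]
  rwa [e₁, e₂] at h

theorem mainTheorem3 (θ : ℝ) (hθ₀ : 0 ≤ θ) (hθπ : θ < π) :
    (θ ≠ π / 3 → ∀ B : EquiangularPolygon 6 θ, B.IsBoat →
      (Joined B.toConfig B.mirror.toConfig ↔ π / 3 < θ ∧ θ < 2 * π / 3)) ∧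
    (∀ B K : EquiangularPolygon 6 θ, B.IsBoat → K.IsChair →
      ¬ Joined B.toConfig K.toConfig) := by
  refine ⟨fun hne B hB => ⟨fun hj => ⟨?_, ?_⟩, fun h => ?_⟩,
    fun B K hB hK => not_joined_boat_chair hθ₀ hθπ.le hB hK⟩
  · refine lt_of_le_of_ne (not_lt.1 fun hlt => ?_) hne.symm
    have := cos_lt_cos_of_nonneg_of_le_pi hθ₀ (by linarith [pi_pos]) hlt
    rw [cos_pi_div_three] at this
    exact not_joined_boat_mirror hθ₀ hθπ.le (by linarith) hB hj
  · by_contra! hle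
    have := cos_le_cos_of_nonneg_of_le_pi (by positivity) hθπ.le hle
    rw [show 2 * π / 3 = π - π / 3 by ring, cos_pi_sub, cos_pi_div_three] at this
    linarith [(hB.param_mem hθ₀ hθπ.le).2]
  · have := cos_lt_cos_of_nonneg_of_le_pi (by positivity) hθπ.le h.1
    rw [cos_pi_div_three] at this
    exact joined_boat_mirror hθ₀ hθπ.le (by linarith) hB
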